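/- Fix an integer $m\ge 1$, an integer $N_0\ge 0$, and real numbers $\lambda$, $c>0$, $\Lambda$, $T_f$ and $\mathscr{A}_-,\mathscr{A}_+\in\mathbb{R}$ (arbitrary Robin parameters). There is a constant $C>0$ depending only on these data (in particular independent of $N$, of the coefficients below, and of $S,T$) such that the following holds. Let $N$ be an integer with $N\ge 2m-1$, write $\mathscr{I}=\{0,1,\dots,N\}$, and let $\alpha_1,\dots,\alpha_m>0$ satisfy $\alpha_1\ge c$ and $\sum_{k=1}^m k^2\alpha_k\le\Lambda$. Put $$\widetilde{\alpha}_k=\alpha_k+N^{-1}\lambda^2\,\frac{k-2}{2}\,\alpha_k-N^{-1}\frac{\lambda^2}{k}\sum_{\ell=k+1}^m(2\ell-k)\alpha_\ell,\qquad 1\le k\le m,$$ and, if $N\ge N_0$, assume $\widetilde\alpha_k\ge 0$ for all $1\le k\le m$. With $\nabla_k\varphi_x=\varphi_{x+k}-\varphi_x$ and $\Delta_k\varphi_x=\varphi_{x+k}+\varphi_{x-k}-2\varphi_x$, define for $\varphi:\{-1,0,\dots,N+1\}\to\mathbb{R}$ and $x\in\mathscr{I}$ $$\mathscr{L}\varphi_x=N^2\,\mathbf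 1_{x=0}\nabla_{-1}\varphi_0+N^2\,\mathbf 1_{x=N}\nabla_{1}\varphi_N+\begin{cases}\frac12\sum_{k=1}^m\widetilde\alpha_k N^2\Delta_k\varphi_x,& m\le x\le N-m,\\ \frac12\sum_{k=1}^m\widetilde\alpha_k N^2\big(\nabla_k\varphi_x+\nabla_{-(k\wedge x)}\varphi_x\big),&0\le x\le m-1,\\ \frac12\sum_{k=1}^m\widetilde\alpha_k N^2\big(\nabla_{-k}\varphi_x+\nabla_{k\wedge(N-x)}\varphi_x\big),&N-m+1\le x\le N.\end{cases}$$ Let $\mathscr{U}^N_{S,T,x,y}$ ($0\le S\le T$, $x\in\{-1,\dots,N+1\}$, $y\in\mathscr{I}$) be the Robin heat kernel, that is, the solution of $$\partial_T\mathscr{U}^N_{S,T,x,y}=\mathscr{L}\,\mathscr{U}^N_{S,T,x,y}\ (x\in\mathscr{I}),\qquad \mathscr{U}^N_{S,S,x,y}=\mathbf 1_{x=y},$$ $$\mathscr{U}^N_{S,T,-1,y}=(1-N^{-1}\mathscr{A}_-)\,\mathscr{U}^N_{S,T,0,y},\qquad \mathscr{U}^N_{S,T,N+1,y}=(1-N^{-1}\mathscr{A}_+)\,\mathscr{U}^N_{S,T,N,y},$$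 where $\mathscr{L}$ acts on the variable $x$. Then for all $0\le S\le T\le T_f$, $$\sup_{x,y\in\mathscr{I}}\big|\mathscr{U}^N_{S,T,x,y}\big|\le C\Big(\big[N^{-1}+N^{-1}|T-S|^{-1/2}\big]\wedge 1\Big),\qquad \sup_{x\in\mathscr{I}}\sum_{y\in\mathscr{I}}\big|\mathscr{U}^N_{S,T,x,y}\big|\le C,$$ where for $S=T$ the bracket is $+\infty$, so that the first bound reads $C$. -/

import Mathlib

namespace RobinHeat

/-- The modified symmetric jump coefficients obtained from the coefficients `α 1, …, α m`,
`α k + N⁻¹ λ² ((k-2)/2) α k - N⁻¹ (λ²/k) ∑_{ℓ=k+1}^m (2ℓ-k) α ℓ`. -/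
noncomputable def alphaTilde (N m : ℕ) (lam : ℝ) (α : ℕ → ℝ) (k : ℕ) : ℝ :=
  α k + (N : ℝ)⁻¹ * lam ^ 2 * (((k : ℝ) - 2) / 2) * α k
    - (N : ℝ)⁻¹ * (lam ^ 2 / (k : ℝ)) *
      ∑ l ∈ Finset.Icc (k + 1) m, (2 * (l : ℝ) - (k : ℝ)) * α l

/-- The lattice gradient `φ (x + k) - φ x`. -/
def grad (k : ℤ) (φ : ℤ → ℝ) (x : ℤ) : ℝ := φ (x + k) - φ x

/-- The lattice Laplacian `φ (x + k) + φ (x - k) - 2 φ x`. -/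
def lap (k : ℤ) (φ : ℤ → ℝ) (x : ℤ) : ℝ := φ (x + k) + φ (x - k) - 2 * φ x

/-- The diffusively rescaled long-range Laplacian on `{0, …, N}` with jump coefficients
`a 1, …, a m`; near the boundary, a jump that would leave `{0, …, N}` is stopped at the
boundary point. For `2 * m ≤ N + 1` and `x` in `{0, …, N}`, exactly one of the three conditions
holds and only values of `φ` on `{0, …, N}` are used. -/
noncomputable def lapOp (N m : ℕ) (a : ℕ → ℝ) (φ : ℤ → ℝ) (x : ℤ) : ℝ :=
  (if (m : ℤ) ≤ x ∧ x ≤ (N : ℤ) - m then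
      1 / 2 * ∑ k ∈ Finset.Icc 1 m, a k * ((N : ℝ) ^ 2 * lap k φ x) else 0)
  + (if 0 ≤ x ∧ x ≤ (m : ℤ) - 1 then
      1 / 2 * ∑ k ∈ Finset.Icc 1 m, a k * ((N : ℝ) ^ 2 * grad k φ x)
      + 1 / 2 * ∑ k ∈ Finset.Icc 1 m, a k * ((N : ℝ) ^ 2 * grad (-(min (k : ℤ) x)) φ x) else 0)
  + (if (N : ℤ) - m + 1 ≤ x ∧ x ≤ (N : ℤ) then
      1 / 2 * ∑ k ∈ Finset.Icc 1 m, a k * ((N : ℝ) ^ 2 * grad (-(k : ℤ)) φ x)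
      + 1 / 2 * ∑ k ∈ Finset.Icc 1 m,
          a k * ((N : ℝ) ^ 2 * grad (min (k : ℤ) ((N : ℤ) - x)) φ x) else 0)

/-- `lapOp` together with the two gradients across the boundary bonds `{-1, 0}` and
`{N, N + 1}`, through which the ghost values at `-1` and `N + 1` enter. -/
noncomputable def bdryLapOp (N m : ℕ) (a : ℕ → ℝ) (φ : ℤ → ℝ) (x : ℤ) : ℝ :=
  lapOp N m a φ x
  + (if x = 0 then (N : ℝ) ^ 2 * grad (-1) φ x else 0)
  + (if x = (N : ℤ) then (N : ℝ) ^ 2 * grad 1 φ x else 0)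

/-- `U S T x y` is the heat kernel on `{0, …, N}` (with ghost points `x = -1` and `x = N + 1`) of
the parabolic problem `∂_T U = bdryLapOp U`, `U S S x y = 1_{x = y}`, with the Robin boundary
conditions `U (-1) = (1 - A₋/N) U 0` and `U (N+1) = (1 - A₊/N) U N`; the operator acts on the
backwards space variable `x`. -/
structure IsRobinHeatKernel (N m : ℕ) (a : ℕ → ℝ) (Aminus Aplus : ℝ)
    (U : ℝ → ℝ → ℤ → ℤ → ℝ) : Prop where
  initial : ∀ S : ℝ, 0 ≤ S → ∀ x ∈ Finset.Icc (0 : ℤ) N, ∀ y ∈ Finset.Icc (0 : ℤ) N,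
    U S S x y = if x = y then 1 else 0
  left_bdry : ∀ S T : ℝ, 0 ≤ S → S ≤ T → ∀ y ∈ Finset.Icc (0 : ℤ) N,
    U S T (-1) y = (1 - (N : ℝ)⁻¹ * Aminus) * U S T 0 y
  right_bdry : ∀ S T : ℝ, 0 ≤ S → S ≤ T → ∀ y ∈ Finset.Icc (0 : ℤ) N,
    U S T (N + 1) y = (1 - (N : ℝ)⁻¹ * Aplus) * U S T N y
  evolution : ∀ S T : ℝ, 0 ≤ S → S ≤ T →
    ∀ x ∈ Finset.Icc (0 : ℤ) N, ∀ y ∈ Finset.Icc (0 : ℤ) N,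
    HasDerivWithinAt (fun R => U S R x y) (bdryLapOp N m a (fun z => U S T z y) x)
      (Set.Ici S) T

/-- The quantity `[N⁻¹ + N⁻¹ ρ^(-1/2)] ∧ 1`, where `0 ^ (-1/2) = ∞`. -/
noncomputable def nashBound (N : ℕ) (ρ : ℝ) : ℝ :=
  if ρ = 0 then 1 else min ((N : ℝ)⁻¹ + (N : ℝ)⁻¹ * ρ ^ (-(1 / 2) : ℝ)) 1

theorem bdryLapOp_add (N m : ℕ) (a : ℕ → ℝ) (φ ψ : ℤ → ℝ) (x : ℤ) :
    bdryLapOp N m a (φ + ψ) x = bdryLapOp N m a φ x + bdryLapOp N m a ψ x := by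
  have hg : ∀ k, grad k (φ + ψ) x = grad k φ x + grad k ψ x := by
    intro k; simp only [grad, Pi.add_apply]; ring
  have hl : ∀ k, lap k (φ + ψ) x = lap k φ x + lap k ψ x := by
    intro k; simp only [lap, Pi.add_apply]; ring
  simp only [bdryLapOp, lapOp, hg, hl, mul_add, Finset.sum_add_distrib]
  split_ifs <;> ring

theorem bdryLapOp_smul (N m : ℕ) (a : ℕ → ℝ) (c : ℝ) (φ : ℤ → ℝ) (x : ℤ) :
    bdryLapOp N m a (c • φ) x = c * bdryLapOp N m a φ x := by
  have hg : ∀ k, grad k (c • φ) x = c * grad k φ x := by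
    intro k; simp only [grad, Pi.smul_apply, smul_eq_mul]; ring
  have hl : ∀ k, lap k (c • φ) x = c * lap k φ x := by
    intro k; simp only [lap, Pi.smul_apply, smul_eq_mul]; ring
  have hs : ∀ f : ℕ → ℝ, ∑ k ∈ Finset.Icc 1 m, a k * ((N : ℝ) ^ 2 * (c * f k))
      = c * ∑ k ∈ Finset.Icc 1 m, a k * ((N : ℝ) ^ 2 * f k) := by
    intro f; rw [Finset.mul_sum]; exact Finset.sum_congr rfl fun k _ => by ring
  simp only [bdryLapOp, lapOp, hg, hl, hs]
  split_ifs <;> ring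

/-- Extension of a function on `{0, …, N}` by the ghost values of the Robin conditions. -/
noncomputable def robinExt (N : ℕ) (Aminus Aplus : ℝ) (v : Fin (N + 1) → ℝ) (z : ℤ) : ℝ :=
  if z = -1 then (1 - (N : ℝ)⁻¹ * Aminus) * v 0
  else if z = (N : ℤ) + 1 then (1 - (N : ℝ)⁻¹ * Aplus) * v (Fin.last N)
  else v (Fin.ofNat (N + 1) z.toNat)

/-- The generator of the Robin problem as a linear map on functions on `{0, …, N}`. -/
noncomputable def robinGen (N m : ℕ) (a : ℕ → ℝ) (Aminus Aplus : ℝ) :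
    (Fin (N + 1) → ℝ) →ₗ[ℝ] (Fin (N + 1) → ℝ) where
  toFun v i := bdryLapOp N m a (robinExt N Aminus Aplus v) ((i : ℕ) : ℤ)
  map_add' v w := by
    have h : robinExt N Aminus Aplus (v + w)
        = robinExt N Aminus Aplus v + robinExt N Aminus Aplus w := by
      funext z
      simp only [robinExt, Pi.add_apply]
      split_ifs <;> ring
    funext i
    simp only [h, bdryLapOp_add, Pi.add_apply]
  map_smul' c v := by
    have h : robinExt N Aminus Aplus (c • v) = c • robinExt N Aminus Aplus v := by
      funext z
      simp only [robinExt, Pi.smul_apply, smul_eq_mul]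
      split_ifs <;> ring
    funext i
    simp only [h, bdryLapOp_smul, Pi.smul_apply, smul_eq_mul, RingHom.id_apply]

/-- The Robin heat kernel exists. -/
theorem exists_isRobinHeatKernel (N m : ℕ) (a : ℕ → ℝ) (Aminus Aplus : ℝ) :
    ∃ U, IsRobinHeatKernel N m a Aminus Aplus U := by
  classical
  let G : (Fin (N + 1) → ℝ) →L[ℝ] (Fin (N + 1) → ℝ) :=
    LinearMap.toContinuousLinearMap (robinGen N m a Aminus Aplus)
  let e : ℤ → Fin (N + 1) → ℝ := fun y => Pi.single (Fin.ofNat (N + 1) y.toNat) 1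
  let u : ℝ → ℤ → Fin (N + 1) → ℝ := fun t y => NormedSpace.exp (t • G) (e y)
  have hu : ∀ t y, HasDerivAt (fun s => u s y) (G (u t y)) t := by
    intro t y
    have h := hasDerivAt_exp_smul_const' (𝕂 := ℝ) G t
    have h2 := ((ContinuousLinearMap.apply ℝ (Fin (N + 1) → ℝ) (e y)).hasFDerivAt
      (x := NormedSpace.exp (t • G))).comp_hasDerivAt t h
    exact h2
  have hfin : ∀ x ∈ Finset.Icc (0 : ℤ) N, (((Fin.ofNat (N + 1) x.toNat : Fin (N + 1)) : ℕ) : ℤ) = x := by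
    intro x hx
    rw [Finset.mem_Icc] at hx
    have : x.toNat % (N + 1) = x.toNat := Nat.mod_eq_of_lt (by omega)
    simp only [Fin.ofNat, this]
    omega
  have hext : ∀ v, ∀ x ∈ Finset.Icc (0 : ℤ) N,
      robinExt N Aminus Aplus v x = v (Fin.ofNat (N + 1) x.toNat) := by
    intro v x hx
    rw [Finset.mem_Icc] at hx
    rw [robinExt, if_neg (by omega), if_neg (by omega)]
  refine ⟨fun S T x y => robinExt N Aminus Aplus (u (T - S) y) x, ?_, ?_, ?_, ?_⟩
  · intro S _ x hx y hy
    have h1 : u (S - S) y = e y := by simp [u]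
    simp only [h1, hext _ x hx, e, Pi.single_apply]
    have : (Fin.ofNat (N + 1) x.toNat = Fin.ofNat (N + 1) y.toNat) ↔ x = y := by
      constructor
      · intro h
        rw [← hfin x hx, ← hfin y hy, h]
      · rintro rfl; rfl
    simp only [this]
  · intro S T _ _ y _
    simp only [hext _ 0 (by simp)]
    simp [robinExt]
  · intro S T _ _ y _
    simp only [hext _ (N : ℤ) (by simp)]
    have h1 : ((N : ℤ) + 1) ≠ -1 := by omega
    simp only [robinExt, if_neg h1, if_true]
    congr 2
    ext
    simp [Fin.ofNat]
  · intro S T _ _ x hx y _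
    have h1 : HasDerivAt (fun R => u (R - S) y) (G (u (T - S) y)) T :=
      HasDerivAt.comp_sub_const T S (hu (T - S) y)
    have h2 := (hasDerivAt_pi.1 h1) (Fin.ofNat (N + 1) x.toNat)
    have h3 : G (u (T - S) y) (Fin.ofNat (N + 1) x.toNat)
        = bdryLapOp N m a (robinExt N Aminus Aplus (u (T - S) y)) x := by
      change bdryLapOp N m a (robinExt N Aminus Aplus (u (T - S) y)) _ = _
      rw [hfin x hx]
    rw [h3] at h2
    simp only [hext _ x hx]
    exact h2.hasDerivWithinAt

end RobinHeat

/-! The ghost values turn the Robin conditions into diagonal terms `-N * Aminus` and `-N * Aplus` at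
the two ends, so the kernel is `exp ((T - S) • G)` with `G = robinMatrix`. For large `N` the
off-diagonal entries of `G` are nonnegative and the nearest-neighbour rates are at least of order `N
^ 2`, which suggests a Nash argument. Two obstacles remain: negative Robin parameters create mass at
rate `N`, and stopping jumps at the ends makes `G` non-symmetric, with column sums that can be of
order `N ^ 2`.

Both are removed by weights of order one: `h` with `G h ≤ K h` and `w` with `Gᵀ w ≤ K w`, where `K`
does not depend on `N` (`IsNashPair`). The weight `h` controls row sums and `w` column sums. For a
column `f = h g` of the kernel, the energy `∑ w h g ^ 2` obeys `Φ' ≤ 2 K Φ - (Dirichlet form)` by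
`two_mul_sum_mul_mulVec`. With `nash_inequality` this gives `ℓ²` decay of order `N⁻¹ + N⁻¹ t ^
(-1/2)`; the transpose gives the same for rows, and splitting `t = t/2 + t/2` yields the pointwise
bound (`exists_heatKernel_bound`).

The right weight is a steep hyperbolic cosine: its slope at the ends beats the Robin terms
(`exists_right_weight`). The left weight solves `freeJumpOp w = r w` in the interior with value one
at the ends. Conservation of mass then forces a negative flux of order `N` at the ends, with a
constant that can be made large (`exists_left_weight`).

For the remaining bounded range of `N` the coefficients may have any sign, but there a crude
exponential bound suffices, since `nashBound N` is at least `N⁻¹`. -/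

open scoped Matrix.Norms.Operator

namespace RobinHeat

/-! ### Exponentials of matrices with nonnegative off-diagonal entries. -/

section MatrixExp

variable {ι : Type*} [Fintype ι] [DecidableEq ι]

theorem exp_entry_nonneg_of_nonneg {A : Matrix ι ι ℝ} (hA : ∀ i j, 0 ≤ A i j) (i j : ι) :
    0 ≤ NormedSpace.exp A i j := by
  have hpow : ∀ (n : ℕ) i j, 0 ≤ (A ^ n) i j := by
    intro n
    induction n with
    | zero => intro i j; rw [pow_zero, Matrix.one_apply]; split_ifs <;> norm_num
    | succ n ih =>
      intro i j
      rw [pow_succ, Matrix.mul_apply]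
      exact Finset.sum_nonneg fun k _ => mul_nonneg (ih i k) (hA k j)
  have h := NormedSpace.exp_series_hasSum_exp' (𝕂 := ℝ) A
  have h2 : HasSum (fun n => ((n.factorial : ℝ)⁻¹ • A ^ n) i j) (NormedSpace.exp A i j) :=
    Pi.hasSum.1 (Pi.hasSum.1 h i) j
  refine h2.nonneg fun n => ?_
  exact mul_nonneg (by positivity) (hpow n i j)

/-- The exponential of a matrix with nonnegative off-diagonal entries is nonnegative. -/
theorem exp_entry_nonneg {A : Matrix ι ι ℝ} (hA : ∀ i j, i ≠ j → 0 ≤ A i j) (i j : ι) :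
    0 ≤ NormedSpace.exp A i j := by
  -- Adding `r • 1` makes every entry nonnegative, and since scalars commute with `A` it only
  -- multiplies the exponential by `exp r`.
  set r : ℝ := ∑ k, |A k k| with hr
  have hB : ∀ i j, 0 ≤ (A + r • (1 : Matrix ι ι ℝ)) i j := by
    intro i j
    rw [Matrix.add_apply, Matrix.smul_apply, Matrix.one_apply]
    split_ifs with h
    · subst h
      have : |A i i| ≤ r :=
        Finset.single_le_sum (f := fun k => |A k k|) (fun k _ => abs_nonneg _) (Finset.mem_univ i)
      have := neg_abs_le (A i i)
      simp only [smul_eq_mul, mul_one]; linarith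
    · simpa using hA i j h
  have h1 : A = (A + r • (1 : Matrix ι ι ℝ)) + (-r) • (1 : Matrix ι ι ℝ) := by
    rw [neg_smul]; abel
  have hc : Commute (A + r • (1 : Matrix ι ι ℝ)) ((-r) • (1 : Matrix ι ι ℝ)) :=
    (Commute.one_right _).smul_right _
  have h2 : NormedSpace.exp ((-r) • (1 : Matrix ι ι ℝ)) = (Real.exp (-r)) • 1 := by
    have := NormedSpace.algebraMap_exp_comm (𝕂 := ℝ) (𝔸 := Matrix ι ι ℝ) (-r)
    rw [Algebra.algebraMap_eq_smul_one, Algebra.algebraMap_eq_smul_one] at this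
    rw [Real.exp_eq_exp_ℝ]
    exact this.symm
  rw [h1, Matrix.exp_add_of_commute _ _ hc, h2, mul_smul_comm, mul_one, Matrix.smul_apply]
  exact mul_nonneg (Real.exp_pos _).le (exp_entry_nonneg_of_nonneg hB i j)

theorem hasDerivAt_exp_mulVec (G : Matrix ι ι ℝ) (v : ι → ℝ) (t : ℝ) :
    HasDerivAt (fun s : ℝ => (NormedSpace.exp (s • G)).mulVec v)
      (G.mulVec ((NormedSpace.exp (t • G)).mulVec v)) t := by
  have h := hasDerivAt_exp_smul_const' (𝕂 := ℝ) G t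
  have h2 : ∀ i j, HasDerivAt (fun s : ℝ => NormedSpace.exp (s • G) i j)
      ((G * NormedSpace.exp (t • G)) i j) t := fun i j => hasDerivAt_pi.1 (hasDerivAt_pi.1 h i) j
  rw [hasDerivAt_pi]
  intro i
  rw [Matrix.mulVec_mulVec]
  exact HasDerivAt.fun_sum fun j _ => (h2 i j).mul_const (v j)

/-- With `G` next to `v`, a pointwise inequality for `G v` can be integrated against the nonnegative
kernel. -/
theorem hasDerivAt_exp_mulVec' (G : Matrix ι ι ℝ) (v : ι → ℝ) (t : ℝ) :
    HasDerivAt (fun s : ℝ => (NormedSpace.exp (s • G)).mulVec v)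
      ((NormedSpace.exp (t • G)).mulVec (G.mulVec v)) t := by
  have h := hasDerivAt_exp_smul_const (𝕂 := ℝ) G t
  have h2 : ∀ i j, HasDerivAt (fun s : ℝ => NormedSpace.exp (s • G) i j)
      ((NormedSpace.exp (t • G) * G) i j) t := fun i j => hasDerivAt_pi.1 (hasDerivAt_pi.1 h i) j
  rw [hasDerivAt_pi]
  intro i
  rw [Matrix.mulVec_mulVec]
  exact HasDerivAt.fun_sum fun j _ => (h2 i j).mul_const (v j)

theorem exp_smul_offDiag_nonneg {G : Matrix ι ι ℝ} (hG : ∀ i j, i ≠ j → 0 ≤ G i j) {t : ℝ}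
    (ht : 0 ≤ t) (i j : ι) : 0 ≤ NormedSpace.exp (t • G) i j :=
  exp_entry_nonneg (fun i j h => mul_nonneg ht (hG i j h)) i j

/-- A supersolution of the generator grows at most exponentially along the semigroup. -/
theorem exp_mulVec_le {G : Matrix ι ι ℝ} (hG : ∀ i j, i ≠ j → 0 ≤ G i j) {h : ι → ℝ} {K : ℝ}
    (hK : ∀ i, G.mulVec h i ≤ K * h i) {t : ℝ} (ht : 0 ≤ t) (i : ι) :
    (NormedSpace.exp (t • G)).mulVec h i ≤ Real.exp (K * t) * h i := by
  -- Its derivative is `exp (-K s)` times the nonnegative kernel applied to `G h - K h ≤ 0`.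
  let φ : ℝ → ℝ := fun s => Real.exp (-(K * s)) * (NormedSpace.exp (s • G)).mulVec h i
  have hd : ∀ s, HasDerivAt φ (Real.exp (-(K * s)) *
      ((NormedSpace.exp (s • G)).mulVec (G.mulVec h) i
        - K * (NormedSpace.exp (s • G)).mulVec h i)) s := by
    intro s
    have h1 : HasDerivAt (fun s : ℝ => Real.exp (-(K * s))) (Real.exp (-(K * s)) * -(K * 1)) s :=
      (((hasDerivAt_id s).const_mul K).neg).exp
    have h2 := hasDerivAt_pi.1 (hasDerivAt_exp_mulVec' G h s) i
    exact (h1.mul h2).congr_deriv (by ring)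
  have hanti : AntitoneOn φ (Set.Ici 0) := by
    refine antitoneOn_of_deriv_nonpos (convex_Ici 0)
      (fun s _ => (hd s).continuousAt.continuousWithinAt)
      (fun s _ => (hd s).differentiableAt.differentiableWithinAt) ?_
    intro s hs
    rw [interior_Ici, Set.mem_Ioi] at hs
    rw [(hd s).deriv]
    refine mul_nonpos_of_nonneg_of_nonpos (Real.exp_pos _).le ?_
    rw [sub_nonpos, Matrix.mulVec, Matrix.mulVec, dotProduct, dotProduct, Finset.mul_sum]
    refine Finset.sum_le_sum fun j _ => ?_
    have := mul_le_mul_of_nonneg_left (hK j) (exp_smul_offDiag_nonneg hG hs.le i j)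
    linarith
  have h0 : φ t ≤ φ 0 := hanti Set.self_mem_Ici ht ht
  have h1 : φ 0 = h i := by simp [φ]
  rw [h1] at h0
  have h2 : (NormedSpace.exp (t • G)).mulVec h i = Real.exp (K * t) * φ t := by
    simp only [φ]
    rw [← mul_assoc, ← Real.exp_add]; simp
  rw [h2]
  exact mul_le_mul_of_nonneg_left h0 (Real.exp_pos _).le

/-- Entries of `exp (t • G)` in terms of the row sums of `G`. -/
theorem sum_abs_exp_le {G : Matrix ι ι ℝ} {B : ℝ} (hB : ∀ i, ∑ j, |G i j| ≤ B) (hB0 : 0 ≤ B) {t : ℝ}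
    (ht : 0 ≤ t) (i : ι) : ∑ j, |NormedSpace.exp (t • G) i j| ≤ Real.exp (t * B) := by
  -- The norm in force is the `ℓ^∞` operator norm, that is, the largest absolute row sum.
  have hrow : ∀ (A : Matrix ι ι ℝ) i, ∑ j, |A i j| ≤ ‖A‖ := by
    intro A i
    rw [Matrix.linfty_opNorm_def]
    have h1 : (∑ j, ‖A i j‖₊) ≤ Finset.univ.sup fun i => ∑ j, ‖A i j‖₊ :=
      Finset.le_sup (f := fun i => ∑ j, ‖A i j‖₊) (Finset.mem_univ i)
    have h2 : ((∑ j, ‖A i j‖₊ : NNReal) : ℝ) ≤ _ := NNReal.coe_le_coe.2 h1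
    simpa using h2
  have hG : ‖G‖ ≤ B := by
    rw [Matrix.linfty_opNorm_def]
    have : (Finset.univ.sup fun i => ∑ j, ‖G i j‖₊) ≤ (⟨B, hB0⟩ : NNReal) := by
      refine Finset.sup_le fun i _ => ?_
      refine NNReal.coe_le_coe.1 ?_
      change ((∑ j, ‖G i j‖₊ : NNReal) : ℝ) ≤ B
      simpa using hB i
    exact NNReal.coe_le_coe.2 this
  have : Nonempty ι := ⟨i⟩
  refine (hrow _ i).trans ?_
  have h3 : ‖NormedSpace.exp (t • G)‖ ≤ Real.exp ‖t • G‖ := by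
    have hs := NormedSpace.exp_series_hasSum_exp' (𝕂 := ℝ) (t • G)
    have hr := NormedSpace.exp_series_hasSum_exp' (𝕂 := ℝ) ‖t • G‖
    rw [← Real.exp_eq_exp_ℝ] at hr
    have hle : ‖∑' n : ℕ, (n.factorial : ℝ)⁻¹ • (t • G) ^ n‖ ≤ Real.exp ‖t • G‖ := by
      refine tsum_of_norm_bounded hr fun n => ?_
      rw [norm_smul, Real.norm_of_nonneg (by positivity), smul_eq_mul]
      exact mul_le_mul_of_nonneg_left (norm_pow_le _ n) (by positivity)
    exact (congrArg norm hs.tsum_eq).symm.trans_le hle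
  refine h3.trans (Real.exp_le_exp.2 ?_)
  rw [norm_smul, Real.norm_of_nonneg ht]
  exact mul_le_mul_of_nonneg_left hG ht

end MatrixExp

/-! ### The discrete Nash inequality and the decay it implies. -/

section Nash

theorem abs_sq_sub_sq_le (g : ℕ → ℝ) (N : ℕ) {x y : ℕ} (hx : x ≤ N) (hy : y ≤ N) :
    |g x ^ 2 - g y ^ 2| ≤ ∑ i ∈ Finset.range N, |g (i + 1) ^ 2 - g i ^ 2| := by
  wlog hxy : x ≤ y generalizing x y
  · rw [abs_sub_comm]; exact this hy hx (by omega)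
  have h := dist_le_Ico_sum_dist (fun i => g i ^ 2) hxy
  rw [Real.dist_eq] at h
  refine h.trans ?_
  have hsub : Finset.Ico x y ⊆ Finset.range N := by
    intro i hi; rw [Finset.mem_Ico] at hi; rw [Finset.mem_range]; omega
  refine (Finset.sum_le_sum_of_subset_of_nonneg hsub fun _ _ _ => dist_nonneg).trans ?_
  refine Finset.sum_le_sum fun i _ => ?_
  rw [Real.dist_eq, abs_sub_comm]

/-- Cauchy–Schwarz applied to `a ^ 2 - b ^ 2 = (a + b) * (a - b)`. -/
theorem sum_abs_sq_sub_sq_le (g : ℕ → ℝ) (N : ℕ) :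
    ∑ i ∈ Finset.range N, |g (i + 1) ^ 2 - g i ^ 2| ≤
      2 * √((∑ i ∈ Finset.range (N + 1), g i ^ 2) *
        ∑ i ∈ Finset.range N, (g (i + 1) - g i) ^ 2) := by
  set S := ∑ i ∈ Finset.range (N + 1), g i ^ 2 with hS
  set D := ∑ i ∈ Finset.range N, (g (i + 1) - g i) ^ 2 with hD
  have hD0 : 0 ≤ D := Finset.sum_nonneg fun i _ => sq_nonneg _
  have h1 : ∑ i ∈ Finset.range N, (g (i + 1) + g i) ^ 2 ≤ 4 * S := by
    have ha : ∑ i ∈ Finset.range N, g i ^ 2 ≤ S := by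
      rw [hS, Finset.sum_range_succ]; nlinarith [sq_nonneg (g N)]
    have hb : ∑ i ∈ Finset.range N, g (i + 1) ^ 2 ≤ S := by
      rw [hS, Finset.sum_range_succ']; nlinarith [sq_nonneg (g 0)]
    calc ∑ i ∈ Finset.range N, (g (i + 1) + g i) ^ 2
        ≤ ∑ i ∈ Finset.range N, (2 * g (i + 1) ^ 2 + 2 * g i ^ 2) :=
          Finset.sum_le_sum fun i _ => by nlinarith [sq_nonneg (g (i + 1) - g i)]
      _ = 2 * ∑ i ∈ Finset.range N, g (i + 1) ^ 2 + 2 * ∑ i ∈ Finset.range N, g i ^ 2 := by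
          rw [Finset.sum_add_distrib, Finset.mul_sum, Finset.mul_sum]
      _ ≤ 4 * S := by linarith
  have h2 := Finset.sum_mul_sq_le_sq_mul_sq (Finset.range N)
    (fun i => |g (i + 1) + g i|) (fun i => |g (i + 1) - g i|)
  simp only [sq_abs] at h2
  have h3 : ∑ i ∈ Finset.range N, |g (i + 1) ^ 2 - g i ^ 2|
      = ∑ i ∈ Finset.range N, |g (i + 1) + g i| * |g (i + 1) - g i| :=
    Finset.sum_congr rfl fun i _ => by rw [← abs_mul]; congr 1; ring
  rw [h3]
  have h4 : 2 * √(S * D) = √(4 * S * D) := by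
    rw [mul_assoc, Real.sqrt_mul (by norm_num) (S * D)]
    congr 1
    rw [show (4 : ℝ) = 2 ^ 2 by norm_num, Real.sqrt_sq (by norm_num)]
  rw [h4]
  exact Real.le_sqrt_of_sq_le (h2.trans (mul_le_mul_of_nonneg_right h1 hD0))

/-- The Nash inequality on a discrete interval. -/
theorem nash_inequality (g : ℕ → ℝ) {N : ℕ} (hN : 1 ≤ N) (hg : ∀ i, 0 ≤ g i)
    (hS : 2 * (∑ i ∈ Finset.range (N + 1), g i) ^ 2 ≤
      N * ∑ i ∈ Finset.range (N + 1), g i ^ 2) :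
    (∑ i ∈ Finset.range (N + 1), g i ^ 2) ^ 3 ≤
      16 * (∑ i ∈ Finset.range (N + 1), g i) ^ 4 *
        ∑ i ∈ Finset.range N, (g (i + 1) - g i) ^ 2 := by
  set S := ∑ i ∈ Finset.range (N + 1), g i ^ 2 with hSdef
  set L := ∑ i ∈ Finset.range (N + 1), g i with hL
  set D := ∑ i ∈ Finset.range N, (g (i + 1) - g i) ^ 2 with hD
  have hN0 : (0 : ℝ) < N := by exact_mod_cast hN
  have hD0 : 0 ≤ D := Finset.sum_nonneg fun i _ => sq_nonneg _
  have hS0 : 0 ≤ S := Finset.sum_nonneg fun i _ => sq_nonneg _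
  have hL0 : 0 ≤ L := Finset.sum_nonneg fun i _ => hg i
  rcases hS0.eq_or_lt with h0 | hSpos
  · rw [← h0, zero_pow (by norm_num)]; positivity
  set V := 2 * √(S * D) with hV
  have hV0 : 0 ≤ V := by positivity
  -- A value of `g ^ 2` exceeds its average by at most its total variation, which `V` bounds.
  set M := S / N + V with hM
  have hM0 : 0 ≤ M := by positivity
  have hsup : ∀ x ∈ Finset.range (N + 1), g x ^ 2 ≤ M := by
    intro x hx
    have h1 : ∀ y ∈ Finset.range (N + 1), g x ^ 2 - V ≤ g y ^ 2 := by
      intro y hy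
      rw [Finset.mem_range] at hx hy
      have := (abs_sq_sub_sq_le g N (by omega : x ≤ N) (by omega : y ≤ N)).trans
        (sum_abs_sq_sub_sq_le g N)
      have := (le_abs_self _).trans this
      linarith
    have h2 := Finset.card_nsmul_le_sum _ _ _ h1
    rw [Finset.card_range, nsmul_eq_mul, ← hSdef] at h2
    by_contra hcon
    push Not at hcon
    have h3 : S / N < g x ^ 2 - V := by linarith
    have h4 : 0 ≤ S / N := by positivity
    have h5 : S = N * (S / N) := by field_simp
    push_cast at h2
    nlinarith
  have h1 : S ≤ √M * L := by
    rw [hSdef, hL, Finset.mul_sum]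
    refine Finset.sum_le_sum fun x hx => ?_
    have := Real.le_sqrt_of_sq_le (hsup x hx)
    rw [sq]
    exact mul_le_mul_of_nonneg_right this (hg x)
  have h2 : S ^ 2 ≤ M * L ^ 2 := by
    have := pow_le_pow_left₀ hS0 h1 2
    rwa [mul_pow, Real.sq_sqrt hM0] at this
  -- The hypothesis `hS`, which fails for nearly constant `g`, lets the average term be absorbed
  -- into the left side.
  have h3 : L ^ 2 * (S / N) ≤ S ^ 2 / 2 := by
    rw [mul_div_assoc', div_le_div_iff₀ hN0 two_pos]
    nlinarith
  have h4 : S ^ 2 ≤ 4 * L ^ 2 * √(S * D) := by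
    have : M * L ^ 2 = L ^ 2 * (S / N) + 2 * L ^ 2 * √(S * D) := by rw [hM, hV]; ring
    linarith
  have h5 := pow_le_pow_left₀ (by positivity) h4 2
  rw [mul_pow, Real.sq_sqrt (by positivity)] at h5
  have h6 : S * S ^ 3 ≤ S * (16 * L ^ 4 * D) := by nlinarith
  exact le_of_mul_le_mul_left h6 hSpos

/-- The Nash inequality for functions on `Fin (N + 1)`. -/
theorem nash_inequality_fin {N : ℕ} (g : Fin (N + 1) → ℝ) (hN : 1 ≤ N) (hg : ∀ i, 0 ≤ g i)
    (hS : 2 * (∑ i, g i) ^ 2 ≤ N * ∑ i, g i ^ 2) :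
    (∑ i, g i ^ 2) ^ 3 ≤
      16 * (∑ i, g i) ^ 4 * ∑ i : Fin N, (g i.succ - g i.castSucc) ^ 2 := by
  let g' : ℕ → ℝ := fun k => g (Fin.ofNat (N + 1) k)
  have h0 : ∀ i : Fin (N + 1), g' i = g i := fun i => by simp [g']
  have e1 : ∑ i ∈ Finset.range (N + 1), g' i = ∑ i, g i := by
    rw [← Fin.sum_univ_eq_sum_range]; exact Finset.sum_congr rfl fun i _ => h0 i
  have e2 : ∑ i ∈ Finset.range (N + 1), g' i ^ 2 = ∑ i, g i ^ 2 := by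
    rw [← Fin.sum_univ_eq_sum_range (fun i => g' i ^ 2)]
    exact Finset.sum_congr rfl fun i _ => by rw [h0]
  have e3 : ∑ i ∈ Finset.range N, (g' (i + 1) - g' i) ^ 2
      = ∑ i : Fin N, (g i.succ - g i.castSucc) ^ 2 := by
    rw [← Fin.sum_univ_eq_sum_range (fun i => (g' (i + 1) - g' i) ^ 2)]
    refine Finset.sum_congr rfl fun i _ => ?_
    rw [← h0 i.succ, ← h0 i.castSucc]; simp
  have := nash_inequality g' hN (fun i => hg _) (by rw [e1, e2]; exact hS)
  rwa [e1, e2, e3] at this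

/-- Decay of a function satisfying the differential inequality produced by a Nash inequality. -/
theorem nash_decay {ψ ψ' : ℝ → ℝ} {B γ T : ℝ} (hB : 0 < B) (hγ : 0 < γ)
    (hd : ∀ t, HasDerivAt ψ (ψ' t) t) (hnp : ∀ t ∈ Set.Icc 0 T, ψ' t ≤ 0)
    (hdec : ∀ t ∈ Set.Icc 0 T, B ≤ ψ t → ψ' t ≤ -(γ * ψ t ^ 3)) (hT : 0 < T) :
    ψ T ≤ B + 1 / √(2 * γ * T) := by
  by_cases hBT : ψ T ≤ B
  · have : 0 ≤ 1 / √(2 * γ * T) := by positivity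
    linarith
  push Not at hBT
  have hanti : AntitoneOn ψ (Set.Icc 0 T) := by
    refine antitoneOn_of_deriv_nonpos (convex_Icc 0 T)
      (fun s _ => (hd s).continuousAt.continuousWithinAt)
      (fun s _ => (hd s).differentiableAt.differentiableWithinAt) ?_
    intro s hs
    rw [interior_Icc] at hs
    rw [(hd s).deriv]
    exact hnp s ⟨hs.1.le, hs.2.le⟩
  -- Monotonicity propagates `B < ψ T` backwards, so the cubic inequality is available on all of
  -- `[0, T]`.
  have hge : ∀ t ∈ Set.Icc 0 T, B < ψ t := fun t ht =>
    hBT.trans_le (hanti ht ⟨hT.le, le_rfl⟩ ht.2)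
  -- The inequality `ψ' ≤ -γ ψ ^ 3` says that `ψ⁻²` grows at rate at least `2 γ`.
  let F : ℝ → ℝ := fun t => (ψ t ^ 2)⁻¹ - 2 * γ * t
  have hF : ∀ t ∈ Set.Icc 0 T, HasDerivAt F (-(2 * ψ t * ψ' t) / (ψ t ^ 2) ^ 2 - 2 * γ) t := by
    intro t ht
    have hpos := hB.trans (hge t ht)
    have h1 := ((hd t).pow 2).inv (pow_pos hpos 2).ne'
    have h2 := (hasDerivAt_id t).const_mul (2 * γ)
    refine (h1.sub h2).congr_deriv ?_
    simp
  have hmono : MonotoneOn F (Set.Icc 0 T) := by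
    refine monotoneOn_of_deriv_nonneg (convex_Icc 0 T)
      (fun s hs => (hF s hs).continuousAt.continuousWithinAt)
      (fun s hs => (hF s (interior_subset hs)).differentiableAt.differentiableWithinAt) ?_
    intro s hs
    have hs := interior_subset hs
    have hpos := hB.trans (hge s hs)
    rw [(hF s hs).deriv, sub_nonneg, le_div_iff₀ (by positivity)]
    have := hdec s hs (hge s hs).le
    nlinarith
  have h0 := hmono ⟨le_rfl, hT.le⟩ ⟨hT.le, le_rfl⟩ hT.le
  have hpos := hB.trans hBT
  have h1 : 0 ≤ (ψ 0 ^ 2)⁻¹ := by positivity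
  have h2 : 2 * γ * T ≤ (ψ T ^ 2)⁻¹ := by simp only [F] at h0; linarith
  have h3 : √(2 * γ * T) ≤ (ψ T)⁻¹ := by
    rw [Real.sqrt_le_left (by positivity), inv_pow]; exact h2
  have h4 : ψ T ≤ 1 / √(2 * γ * T) := by
    rw [le_div_iff₀ (by positivity)]
    calc ψ T * √(2 * γ * T) ≤ ψ T * (ψ T)⁻¹ := by gcongr
      _ = 1 := mul_inv_cancel₀ hpos.ne'
  linarith

end Nash

/-! ### Heat kernel bounds from a pair of weights. -/

section NashSemigroup

/-- The symmetrised Dirichlet form attached to a generator and two weights. -/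
theorem two_mul_sum_mul_mulVec {ι : Type*} [Fintype ι] (G : Matrix ι ι ℝ) (w h g : ι → ℝ) :
    2 * ∑ x, w x * g x * G.mulVec (fun y => h y * g y) x
      = ∑ x, w x * g x ^ 2 * G.mulVec h x + ∑ y, h y * g y ^ 2 * G.transpose.mulVec w y
        - ∑ x, ∑ y, w x * G x y * h y * (g x - g y) ^ 2 := by
  have h1 : ∑ y, h y * g y ^ 2 * G.transpose.mulVec w y
      = ∑ x, ∑ y, h y * g y ^ 2 * (G x y * w x) := by
    rw [Finset.sum_comm]
    refine Finset.sum_congr rfl fun y _ => ?_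
    rw [Matrix.mulVec, dotProduct, Finset.mul_sum]
    rfl
  have h2 : ∑ x, w x * g x ^ 2 * G.mulVec h x = ∑ x, ∑ y, w x * g x ^ 2 * (G x y * h y) := by
    refine Finset.sum_congr rfl fun y _ => ?_
    rw [Matrix.mulVec, dotProduct, Finset.mul_sum]
  rw [h1, h2, ← Finset.sum_add_distrib, ← Finset.sum_sub_distrib, Finset.mul_sum]
  refine Finset.sum_congr rfl fun x _ => ?_
  rw [← Finset.sum_add_distrib, ← Finset.sum_sub_distrib, Matrix.mulVec, dotProduct,
    Finset.mul_sum, Finset.mul_sum]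
  -- Termwise this is `2 g x g y = g x ^ 2 + g y ^ 2 - (g x - g y) ^ 2`.
  exact Finset.sum_congr rfl fun y _ => by ring

/-- A generator on `{0, …, N}` with nearest neighbour rates of order `N ^ 2`, together with a
supersolution `h` of the generator and a supersolution `w` of its transpose, both of order one. -/
structure IsNashPair {N : ℕ} (G : Matrix (Fin (N + 1)) (Fin (N + 1)) ℝ) (w h : Fin (N + 1) → ℝ)
    (κ K c : ℝ) : Prop where
  offDiag : ∀ i j, i ≠ j → 0 ≤ G i j
  left_lower : ∀ i, κ⁻¹ ≤ w i
  left_upper : ∀ i, w i ≤ κ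
  right_lower : ∀ i, κ⁻¹ ≤ h i
  right_upper : ∀ i, h i ≤ κ
  right_super : ∀ i, G.mulVec h i ≤ K * h i
  left_super : ∀ i, G.transpose.mulVec w i ≤ K * w i
  rate_succ : ∀ i : Fin N, c * (N : ℝ) ^ 2 ≤ G i.castSucc i.succ
  rate_pred : ∀ i : Fin N, c * (N : ℝ) ^ 2 ≤ G i.succ i.castSucc

variable {N : ℕ} {G : Matrix (Fin (N + 1)) (Fin (N + 1)) ℝ} {w h : Fin (N + 1) → ℝ}
  {κ K c : ℝ}

/-- The notion is self-dual, so bounds on columns of the kernel also give bounds on rows. -/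
theorem IsNashPair.transpose (hG : IsNashPair G w h κ K c) :
    IsNashPair G.transpose h w κ K c where
  offDiag i j hij := hG.offDiag j i hij.symm
  left_lower := hG.right_lower
  left_upper := hG.right_upper
  right_lower := hG.left_lower
  right_upper := hG.left_upper
  right_super := hG.left_super
  left_super := by simpa using hG.right_super
  rate_succ := hG.rate_pred
  rate_pred := hG.rate_succ

/-- All terms are nonnegative; only the bonds from `x` to `x + 1` are kept. -/
theorem IsNashPair.dirichlet_lower (hG : IsNashPair G w h κ K c) (hκ : 0 < κ)
    (hc : 0 ≤ c) (g : Fin (N + 1) → ℝ) :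
    κ⁻¹ ^ 2 * (c * (N : ℝ) ^ 2) * ∑ i : Fin N, (g i.succ - g i.castSucc) ^ 2
      ≤ ∑ x, ∑ y, w x * G x y * h y * (g x - g y) ^ 2 := by
  have hκ' : 0 < κ⁻¹ := inv_pos.2 hκ
  have hw : ∀ i, 0 ≤ w i := fun i => hκ'.le.trans (hG.left_lower i)
  have hh : ∀ i, 0 ≤ h i := fun i => hκ'.le.trans (hG.right_lower i)
  have hnn : ∀ x y, 0 ≤ w x * G x y * h y * (g x - g y) ^ 2 := by
    intro x y
    by_cases hxy : x = y
    · subst hxy; simp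
    · exact mul_nonneg (mul_nonneg (mul_nonneg (hw x) (hG.offDiag x y hxy)) (hh y)) (sq_nonneg _)
  rw [Fin.sum_univ_castSucc, Finset.mul_sum]
  refine le_add_of_le_of_nonneg (Finset.sum_le_sum fun i _ => ?_)
    (Finset.sum_nonneg fun y _ => hnn _ y)
  refine le_trans ?_ (Finset.single_le_sum (fun y _ => hnn i.castSucc y) (Finset.mem_univ i.succ))
  rw [show (g i.castSucc - g i.succ) ^ 2 = (g i.succ - g i.castSucc) ^ 2 by ring]
  refine mul_le_mul_of_nonneg_right ?_ (sq_nonneg _)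
  have h1 : κ⁻¹ * (c * (N : ℝ) ^ 2) ≤ w i.castSucc * G i.castSucc i.succ :=
    mul_le_mul (hG.left_lower _) (hG.rate_succ i) (by positivity) (hw _)
  have h2 := mul_le_mul h1 (hG.right_lower i.succ) hκ'.le
    (le_trans (by positivity) h1)
  linarith

/-- The `ℓ²` decay of the columns of the heat kernel. -/
theorem IsNashPair.sum_sq_exp_le (hG : IsNashPair G w h κ K c) (hN : 1 ≤ N) (hκ : 1 ≤ κ)
    (hK : 0 ≤ K) (hc : 0 < c) {t T : ℝ} (ht : 0 < t) (htT : t ≤ T) (y : Fin (N + 1)) {M : ℝ}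
    (hM : M = κ ^ 3 * Real.exp (K * T)) :
    ∑ z, NormedSpace.exp (t • G) z y ^ 2 ≤
      κ ^ 4 * Real.exp (2 * K * T) * (2 * κ ^ 2 * M ^ 2 + 1 / √(c / (8 * κ ^ 8 * M ^ 4))) *
        ((N : ℝ)⁻¹ + (N : ℝ)⁻¹ * (√t)⁻¹) := by
  have hκ0 : 0 < κ := by linarith
  have hκ' : 0 < κ⁻¹ := inv_pos.2 hκ0
  have hw : ∀ i, 0 < w i := fun i => hκ'.trans_le (hG.left_lower i)
  have hh : ∀ i, 0 < h i := fun i => hκ'.trans_le (hG.right_lower i)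
  have hN0 : (0 : ℝ) < N := by exact_mod_cast hN
  have hM0 : 0 < M := by rw [hM]; positivity
  let f : ℝ → Fin (N + 1) → ℝ := fun s => (NormedSpace.exp (s • G)).mulVec (Pi.single y 1)
  have hfe : ∀ s z, f s z = NormedSpace.exp (s • G) z y := by
    intro s z; simp only [f]; rw [Matrix.mulVec_single_one]; rfl
  have hf0 : ∀ s, 0 ≤ s → ∀ z, 0 ≤ f s z := by
    intro s hs z; rw [hfe]; exact exp_smul_offDiag_nonneg hG.offDiag hs z y
  let g : ℝ → Fin (N + 1) → ℝ := fun s z => f s z / h z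
  have hg0 : ∀ s, 0 ≤ s → ∀ z, 0 ≤ g s z := fun s hs z => div_nonneg (hf0 s hs z) (hh z).le
  have hfg : ∀ s, f s = fun z => h z * g s z := by
    intro s; funext z; simp only [g]; field_simp [(hh z).ne']
  have hone : κ⁻¹ * κ = 1 := inv_mul_cancel₀ hκ0.ne'
  -- The left weight bounds `∑ w f` by `exp (K s) * w y`; passing from `g` to `w f` costs `κ ^ 2`,
  -- and `w y` costs one more `κ`.
  have hS1 : ∀ s ∈ Set.Icc 0 t, ∑ z, g s z ≤ M := by
    intro s hs
    have h1 : ∑ z, w z * f s z ≤ Real.exp (K * s) * w y := by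
      have h2 := exp_mulVec_le hG.transpose.offDiag hG.left_super hs.1 y
      rw [← Matrix.transpose_smul, Matrix.exp_transpose, Matrix.mulVec, dotProduct] at h2
      refine le_of_eq_of_le (Finset.sum_congr rfl fun z _ => ?_) h2
      rw [hfe, Matrix.transpose_apply, mul_comm]
    have h3 : ∑ z, g s z ≤ κ ^ 2 * ∑ z, w z * f s z := by
      rw [Finset.mul_sum]
      refine Finset.sum_le_sum fun z _ => ?_
      have hfz := hf0 s hs.1 z
      have h4 : g s z ≤ κ * f s z := by
        simp only [g]
        rw [div_le_iff₀ (hh z)]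
        have := mul_le_mul_of_nonneg_left (hG.right_lower z) (mul_nonneg hκ0.le hfz)
        nlinarith
      have h5 : f s z ≤ κ * (w z * f s z) := by
        have := mul_le_mul_of_nonneg_left (hG.left_lower z) (mul_nonneg hκ0.le hfz)
        nlinarith
      have := mul_le_mul_of_nonneg_left h5 hκ0.le
      nlinarith
    have h6 : Real.exp (K * s) * w y ≤ Real.exp (K * T) * κ :=
      mul_le_mul (Real.exp_le_exp.2 (mul_le_mul_of_nonneg_left (hs.2.trans htT) hK))
        (hG.left_upper y) (hw y).le (Real.exp_pos _).le
    calc ∑ z, g s z ≤ κ ^ 2 * ∑ z, w z * f s z := h3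
      _ ≤ κ ^ 2 * (Real.exp (K * T) * κ) := by gcongr; exact h1.trans h6
      _ = M := by rw [hM]; ring
  let Φ : ℝ → ℝ := fun s => ∑ z, w z / h z * f s z ^ 2
  have hΦg : ∀ s, Φ s = ∑ z, w z * h z * g s z ^ 2 := by
    intro s
    refine Finset.sum_congr rfl fun z _ => ?_
    rw [hfg]; field_simp [(hh z).ne']
  have hΦ' : ∀ s, HasDerivAt Φ (2 * ∑ z, w z * g s z * G.mulVec (f s) z) s := by
    intro s
    have h1 := hasDerivAt_pi.1 (hasDerivAt_exp_mulVec G (Pi.single y 1) s)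
    have h2 : HasDerivAt Φ (∑ z, w z / h z * (2 * f s z * G.mulVec (f s) z)) s := by
      refine HasDerivAt.fun_sum fun z _ => ?_
      have := ((h1 z).pow 2).const_mul (w z / h z)
      refine this.congr_deriv ?_
      simp [f]
    refine h2.congr_deriv ?_
    rw [Finset.mul_sum]
    refine Finset.sum_congr rfl fun z _ => ?_
    simp only [g]; ring
  let D : ℝ → ℝ := fun s => ∑ i : Fin N, (g s i.succ - g s i.castSucc) ^ 2
  have hD0 : ∀ s, 0 ≤ D s := fun s => Finset.sum_nonneg fun i _ => sq_nonneg _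
  have hΦd : ∀ s, 2 * ∑ z, w z * g s z * G.mulVec (f s) z - 2 * K * Φ s
      ≤ -(κ⁻¹ ^ 2 * (c * (N : ℝ) ^ 2) * D s) := by
    intro s
    have h1 := two_mul_sum_mul_mulVec G w h (g s)
    rw [← hfg s] at h1
    have h2 := hG.dirichlet_lower hκ0 hc.le (g s)
    have h3 : ∑ x, w x * g s x ^ 2 * G.mulVec h x ≤ K * Φ s := by
      rw [hΦg, Finset.mul_sum]
      refine Finset.sum_le_sum fun x _ => ?_
      have := mul_le_mul_of_nonneg_left (hG.right_super x)
        (mul_nonneg (hw x).le (sq_nonneg (g s x)))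
      linarith
    have h4 : ∑ x, h x * g s x ^ 2 * G.transpose.mulVec w x ≤ K * Φ s := by
      rw [hΦg, Finset.mul_sum]
      refine Finset.sum_le_sum fun x _ => ?_
      have := mul_le_mul_of_nonneg_left (hG.left_super x)
        (mul_nonneg (hh x).le (sq_nonneg (g s x)))
      linarith
    simp only [D]
    linarith
  have hS2lower : ∀ s, Φ s ≤ κ ^ 2 * ∑ z, g s z ^ 2 := by
    intro s
    rw [hΦg, Finset.mul_sum]
    refine Finset.sum_le_sum fun z _ => ?_
    rw [sq κ]
    exact mul_le_mul_of_nonneg_right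
      (mul_le_mul (hG.left_upper z) (hG.right_upper z) (hh z).le hκ0.le) (sq_nonneg _)
  have hΦ0 : ∀ s, 0 ≤ Φ s := fun s =>
    Finset.sum_nonneg fun z _ => mul_nonneg (div_nonneg (hw z).le (hh z).le) (sq_nonneg _)
  let e : ℝ → ℝ := fun s => Real.exp (-(2 * K * s))
  have he0 : ∀ s, 0 < e s := fun s => Real.exp_pos _
  have he1 : ∀ s, 0 ≤ s → e s ≤ 1 := fun s hs =>
    Real.exp_le_one_iff.2 (by have : 0 ≤ 2 * K * s := by positivity
                              linarith)
  -- The factor `e` cancels the growth `2 K Φ`, leaving only the dissipation.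
  let ψ : ℝ → ℝ := fun s => e s * Φ s
  have hψd : ∀ s, HasDerivAt ψ
      (e s * (2 * ∑ z, w z * g s z * G.mulVec (f s) z - 2 * K * Φ s)) s := by
    intro s
    have h1 : HasDerivAt e (e s * -(2 * K * 1)) s := (((hasDerivAt_id s).const_mul (2 * K)).neg).exp
    exact (h1.mul (hΦ' s)).congr_deriv (by ring)
  -- Here `16 * M ^ 4` comes from Nash, `κ ^ 6` from comparing `Φ ^ 3` with `(∑ g ^ 2) ^ 3`, and `κ
  -- ^ 2` from the weights in the Dirichlet form. The threshold `B` below is where `Φ ≥ B`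
  -- guarantees the hypothesis of the Nash inequality.
  set γ : ℝ := c * (N : ℝ) ^ 2 / (16 * κ ^ 8 * M ^ 4) with hγ
  have hγ0 : 0 < γ := by positivity
  have hdecay := nash_decay (B := 2 * κ ^ 2 * M ^ 2 / N) (γ := γ) (T := t) (by positivity) hγ0 hψd
    (by
      intro s _
      refine mul_nonpos_of_nonneg_of_nonpos (he0 s).le ((hΦd s).trans ?_)
      have := hD0 s
      rw [neg_nonpos]; positivity)
    (by
      intro s hs hB
      have hS2 := hS2lower s
      have hψΦ : ψ s ≤ Φ s := by
        simpa using mul_le_mul_of_nonneg_right (he1 s hs.1) (hΦ0 s)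
      have hSnn : 0 ≤ ∑ z, g s z := Finset.sum_nonneg fun z _ => hg0 s hs.1 z
      have h1 : 2 * (∑ z, g s z) ^ 2 ≤ N * ∑ z, g s z ^ 2 := by
        have h2 : (∑ z, g s z) ^ 2 ≤ M ^ 2 := pow_le_pow_left₀ hSnn (hS1 s hs) 2
        have h3 : 2 * κ ^ 2 * M ^ 2 ≤ N * (κ ^ 2 * ∑ z, g s z ^ 2) := by
          have := (div_le_iff₀' hN0).1 (hB.trans (hψΦ.trans hS2))
          linarith
        have h4 : κ ^ 2 * (2 * M ^ 2) ≤ κ ^ 2 * (N * ∑ z, g s z ^ 2) := by linarith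
        have := le_of_mul_le_mul_left h4 (by positivity)
        linarith
      have h2 := nash_inequality_fin (g s) hN (hg0 s hs.1) h1
      have h3 : (∑ z, g s z ^ 2) ^ 3 ≤ 16 * M ^ 4 * D s :=
        h2.trans (mul_le_mul_of_nonneg_right
          (mul_le_mul_of_nonneg_left (pow_le_pow_left₀ hSnn (hS1 s hs) 4) (by norm_num)) (hD0 s))
      have h4 : Φ s ^ 3 ≤ κ ^ 6 * (16 * M ^ 4 * D s) := by
        have := pow_le_pow_left₀ (hΦ0 s) hS2 3
        rw [mul_pow, ← pow_mul] at this
        exact this.trans (mul_le_mul_of_nonneg_left h3 (by positivity))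
      have h5 : γ * Φ s ^ 3 ≤ κ⁻¹ ^ 2 * (c * (N : ℝ) ^ 2) * D s := by
        calc γ * Φ s ^ 3 ≤ γ * (κ ^ 6 * (16 * M ^ 4 * D s)) := by gcongr
          _ = _ := by rw [hγ]; field_simp
      have h6 : ψ s ^ 3 ≤ e s * Φ s ^ 3 := by
        have h7 : e s ^ 2 ≤ 1 := pow_le_one₀ (he0 s).le (he1 s hs.1)
        have h8 : 0 ≤ e s * Φ s ^ 3 := mul_nonneg (he0 s).le (pow_nonneg (hΦ0 s) 3)
        calc ψ s ^ 3 = e s ^ 2 * (e s * Φ s ^ 3) := by simp only [ψ]; ring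
          _ ≤ 1 * (e s * Φ s ^ 3) := mul_le_mul_of_nonneg_right h7 h8
          _ = _ := one_mul _
      have h9 := mul_le_mul_of_nonneg_left ((hΦd s).trans (neg_le_neg h5)) (he0 s).le
      have h10 := mul_le_mul_of_nonneg_left h6 hγ0.le
      linarith)
    ht
  have hfinal : ∑ z, f t z ^ 2 ≤ κ ^ 2 * Φ t := by
    rw [Finset.mul_sum]
    refine Finset.sum_le_sum fun z _ => ?_
    have h1 : 1 ≤ κ ^ 2 * (w z / h z) := by
      rw [mul_div_assoc', le_div_iff₀ (hh z), one_mul]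
      have := mul_le_mul_of_nonneg_left (hG.left_lower z) (sq_nonneg κ)
      have h2 : κ ^ 2 * κ⁻¹ = κ := by field_simp
      linarith [hG.right_upper z]
    nlinarith [sq_nonneg (f t z)]
  have hΦψ : Φ t = Real.exp (2 * K * t) * ψ t := by
    simp only [ψ, e]; rw [← mul_assoc, ← Real.exp_add]; simp
  have hψ0 : 0 ≤ ψ t := mul_nonneg (he0 t).le (hΦ0 t)
  have hsqrt : √(2 * γ * t) = N * √(c / (8 * κ ^ 8 * M ^ 4)) * √t := by
    have : 2 * γ * t = (N : ℝ) ^ 2 * (c / (8 * κ ^ 8 * M ^ 4)) * t := by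
      rw [hγ]; field_simp; norm_num
    rw [this, Real.sqrt_mul (by positivity), Real.sqrt_mul (by positivity), Real.sqrt_sq hN0.le]
  rw [hsqrt] at hdecay
  set q := √(c / (8 * κ ^ 8 * M ^ 4)) with hq
  have hq0 : 0 < q := by positivity
  have ht0 : 0 < √t := Real.sqrt_pos.2 ht
  have hexp : Real.exp (2 * K * t) ≤ Real.exp (2 * K * T) :=
    Real.exp_le_exp.2 (by gcongr)
  calc ∑ z, NormedSpace.exp (t • G) z y ^ 2 = ∑ z, f t z ^ 2 :=
        Finset.sum_congr rfl fun z _ => by rw [hfe]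
    _ ≤ κ ^ 2 * (Real.exp (2 * K * t) * ψ t) := by rw [← hΦψ]; exact hfinal
    _ ≤ κ ^ 4 * (Real.exp (2 * K * T) * (2 * κ ^ 2 * M ^ 2 / N + 1 / (N * q * √t))) := by
        have : κ ^ 2 ≤ κ ^ 4 := pow_le_pow_right₀ hκ (by norm_num)
        gcongr
    _ = κ ^ 4 * Real.exp (2 * K * T) *
        (2 * κ ^ 2 * M ^ 2 * (N : ℝ)⁻¹ + 1 / q * ((N : ℝ)⁻¹ * (√t)⁻¹)) := by
        field_simp
    _ ≤ _ := by
        rw [mul_assoc (κ ^ 4 * Real.exp (2 * K * T))]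
        refine mul_le_mul_of_nonneg_left ?_ (by positivity)
        have h1 : 0 ≤ 2 * κ ^ 2 * M ^ 2 * ((N : ℝ)⁻¹ * (√t)⁻¹) := by positivity
        have h2 : 0 ≤ 1 / q * (N : ℝ)⁻¹ := by positivity
        nlinarith

/-- Uniform heat kernel and row sum bounds for generators with a pair of weights. -/
theorem exists_heatKernel_bound (κ K c T : ℝ) (hκ : 1 ≤ κ) (hK : 0 ≤ K) (hc : 0 < c) :
    ∃ C : ℝ, 0 < C ∧ ∀ (N : ℕ) (G : Matrix (Fin (N + 1)) (Fin (N + 1)) ℝ)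
      (w h : Fin (N + 1) → ℝ), 1 ≤ N → IsNashPair G w h κ K c → ∀ t : ℝ, 0 ≤ t → t ≤ T →
        (∀ x y, |NormedSpace.exp (t • G) x y| ≤ C * nashBound N t) ∧
        ∀ x, ∑ y, |NormedSpace.exp (t • G) x y| ≤ C := by
  obtain ⟨M, hM⟩ : ∃ M, M = κ ^ 3 * Real.exp (K * T) := ⟨_, rfl⟩
  have hM0 : 0 < M := by rw [hM]; positivity
  set C₁ : ℝ := κ ^ 4 * Real.exp (2 * K * T) *
    (2 * κ ^ 2 * M ^ 2 + 1 / √(c / (8 * κ ^ 8 * M ^ 4))) with hC₁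
  have hC₁0 : 0 < C₁ := by positivity
  set C₂ : ℝ := κ ^ 2 * Real.exp (K * T) with hC₂
  have hC₂0 : 0 < C₂ := by positivity
  refine ⟨2 * C₁ + C₂, by positivity, ?_⟩
  intro N G w h hN hG t ht htT
  have hκ0 : 0 < κ := by linarith
  have hN0 : (0 : ℝ) < N := by exact_mod_cast hN
  have hnn : ∀ s : ℝ, 0 ≤ s → ∀ x y, 0 ≤ NormedSpace.exp (s • G) x y :=
    fun s hs x y => exp_smul_offDiag_nonneg hG.offDiag hs x y
  have hrow : ∀ x, ∑ y, |NormedSpace.exp (t • G) x y| ≤ C₂ := by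
    intro x
    have h1 := exp_mulVec_le hG.offDiag hG.right_super ht x
    rw [Matrix.mulVec, dotProduct] at h1
    have h2 : ∑ y, |NormedSpace.exp (t • G) x y|
        ≤ κ * ∑ y, NormedSpace.exp (t • G) x y * h y := by
      rw [Finset.mul_sum]
      refine Finset.sum_le_sum fun y _ => ?_
      rw [abs_of_nonneg (hnn t ht x y)]
      have h3 := mul_le_mul_of_nonneg_left (hG.right_lower y) (hnn t ht x y)
      calc NormedSpace.exp (t • G) x y = κ * (NormedSpace.exp (t • G) x y * κ⁻¹) := by field_simp
        _ ≤ _ := mul_le_mul_of_nonneg_left h3 hκ0.le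
    have h4 : Real.exp (K * t) * h x ≤ Real.exp (K * T) * κ :=
      mul_le_mul (Real.exp_le_exp.2 (mul_le_mul_of_nonneg_left htT hK)) (hG.right_upper x)
        ((inv_pos.2 hκ0).le.trans (hG.right_lower x)) (Real.exp_pos _).le
    calc _ ≤ _ := h2
      _ ≤ κ * (Real.exp (K * T) * κ) := by gcongr; exact h1.trans h4
      _ = C₂ := by rw [hC₂]; ring
  refine ⟨fun x y => ?_, fun x => (hrow x).trans (by linarith)⟩
  -- An entry is at most its row sum; this covers `t = 0` and the truncation at one in `nashBound`.
  have hone : |NormedSpace.exp (t • G) x y| ≤ C₂ :=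
    (Finset.single_le_sum (f := fun y => |NormedSpace.exp (t • G) x y|)
      (fun _ _ => abs_nonneg _) (Finset.mem_univ y)).trans (hrow x)
  rw [nashBound]
  split_ifs with h0
  · linarith
  have htpos : 0 < t := lt_of_le_of_ne ht (Ne.symm h0)
  rw [mul_min_of_nonneg _ _ (by positivity)]
  refine le_min ?_ (by linarith)
  have hs : 0 < t / 2 := by positivity
  have hsT : t / 2 ≤ T := by linarith
  have hsplit : NormedSpace.exp (t • G)
      = NormedSpace.exp ((t / 2) • G) * NormedSpace.exp ((t / 2) • G) := by
    rw [← Matrix.exp_add_of_commute _ _ (Commute.refl _), ← add_smul, add_halves]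
  have hcol := hG.sum_sq_exp_le hN hκ hK hc hs hsT y hM
  have hrow2 := hG.transpose.sum_sq_exp_le hN hκ hK hc hs hsT x hM
  rw [← Matrix.transpose_smul, Matrix.exp_transpose] at hrow2
  simp only [Matrix.transpose_apply] at hrow2
  -- The half-time kernels are multiplied and `a b ≤ (a ^ 2 + b ^ 2) / 2` separates the `ℓ²` norms
  -- of a row and a column.
  have hcs : |NormedSpace.exp (t • G) x y| ≤ C₁ * ((N : ℝ)⁻¹ + (N : ℝ)⁻¹ * (√(t / 2))⁻¹) := by
    rw [abs_of_nonneg (hnn t ht x y), hsplit, Matrix.mul_apply]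
    have h1 : ∀ z, NormedSpace.exp ((t / 2) • G) x z * NormedSpace.exp ((t / 2) • G) z y
        ≤ (NormedSpace.exp ((t / 2) • G) x z ^ 2 + NormedSpace.exp ((t / 2) • G) z y ^ 2) / 2 :=
      fun z => by
        nlinarith [sq_nonneg (NormedSpace.exp ((t / 2) • G) x z
          - NormedSpace.exp ((t / 2) • G) z y)]
    refine (Finset.sum_le_sum fun z _ => h1 z).trans ?_
    rw [← Finset.sum_div, Finset.sum_add_distrib]
    linarith
  have hsq : (√(t / 2))⁻¹ ≤ 2 * t ^ (-(1 / 2) : ℝ) := by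
    rw [Real.rpow_neg ht, ← Real.sqrt_eq_rpow]
    have h2 : √t ≤ 2 * √(t / 2) := by
      rw [Real.sqrt_le_left (by positivity), mul_pow, Real.sq_sqrt hs.le]
      linarith
    have h3 : 0 < √(t / 2) := Real.sqrt_pos.2 hs
    have h4 : 0 < √t := Real.sqrt_pos.2 htpos
    rw [← div_eq_mul_inv, inv_eq_one_div, div_le_div_iff₀ h3 h4]
    linarith
  have hp : 0 < t ^ (-(1 / 2) : ℝ) := Real.rpow_pos_of_pos htpos _
  have hNi : 0 < (N : ℝ)⁻¹ := inv_pos.2 hN0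
  calc _ ≤ _ := hcs
    _ ≤ C₁ * ((N : ℝ)⁻¹ + (N : ℝ)⁻¹ * (2 * t ^ (-(1 / 2) : ℝ))) := by gcongr
    _ ≤ 2 * C₁ * ((N : ℝ)⁻¹ + (N : ℝ)⁻¹ * t ^ (-(1 / 2) : ℝ)) := by
        have : 0 ≤ C₁ * (N : ℝ)⁻¹ := by positivity
        linarith
    _ ≤ _ := by gcongr; linarith

end NashSemigroup

/-! ### The stopped jump operator, its adjoint, and the Robin matrix. -/

section JumpOperator

/-- The generator of jumps of length `k ≤ m` at rate `b k`, stopped at the ends of `{0, …, N}`. -/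
noncomputable def jumpOp (N m : ℕ) (b : ℕ → ℝ) (φ : ℤ → ℝ) (x : ℤ) : ℝ :=
  ∑ k ∈ Finset.Icc 1 m, b k * (φ (min (x + k) N) + φ (max (x - k) 0) - 2 * φ x)

/-- The symmetric generator of jumps of length `k ≤ m` at rate `b k` on `ℤ`. -/
noncomputable def freeJumpOp (m : ℕ) (b : ℕ → ℝ) (φ : ℤ → ℝ) (x : ℤ) : ℝ :=
  ∑ k ∈ Finset.Icc 1 m, b k * (φ (x + k) + φ (x - k) - 2 * φ x)

/-- Since `2 * m ≤ N + 1`, no point is within reach of both walls, so in each of the three regions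
at most one of the truncations `min`, `max` acts. -/
theorem lapOp_eq_jumpOp {N m : ℕ} (hN : 2 * m ≤ N + 1) (a : ℕ → ℝ) (φ : ℤ → ℝ) {x : ℤ}
    (hx : x ∈ Finset.Icc (0 : ℤ) N) :
    lapOp N m a φ x = (N : ℝ) ^ 2 * jumpOp N m (fun k => a k / 2) φ x := by
  rw [Finset.mem_Icc] at hx
  rw [lapOp, jumpOp]
  rcases lt_or_ge x m with h1 | h1
  · rw [if_neg (by omega), if_pos (by omega), if_neg (by omega)]
    simp only [Finset.mul_sum, zero_add, add_zero]
    rw [← Finset.sum_add_distrib]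
    refine Finset.sum_congr rfl fun k hk => ?_
    rw [Finset.mem_Icc] at hk
    rw [grad, grad, show min (x + k) (N : ℤ) = x + k by omega,
      show x + -(min (k : ℤ) x) = max (x - k) 0 by omega]
    ring
  rcases le_or_gt x ((N : ℤ) - m) with h2 | h2
  · rw [if_pos (by omega), if_neg (by omega), if_neg (by omega)]
    simp only [Finset.mul_sum, add_zero]
    refine Finset.sum_congr rfl fun k hk => ?_
    rw [Finset.mem_Icc] at hk
    rw [lap, show min (x + k) (N : ℤ) = x + k by omega, show max (x - k) (0 : ℤ) = x - k by omega]
    ring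
  · rw [if_neg (by omega), if_neg (by omega), if_pos (by omega)]
    simp only [Finset.mul_sum, zero_add]
    rw [← Finset.sum_add_distrib]
    refine Finset.sum_congr rfl fun k hk => ?_
    rw [Finset.mem_Icc] at hk
    rw [grad, grad, show x + min (k : ℤ) (N - x) = min (x + k) (N : ℤ) by omega,
      show max (x - k) 0 = x + -(k : ℤ) by omega]
    ring

theorem sum_fin_eq_sum_Icc (N : ℕ) (f : ℤ → ℝ) :
    ∑ i : Fin (N + 1), f ((i : ℕ) : ℤ) = ∑ x ∈ Finset.Icc (0 : ℤ) N, f x := by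
  rw [Fin.sum_univ_eq_sum_range (fun i => f (i : ℤ)) (N + 1)]
  refine Finset.sum_bij (fun i _ => (i : ℤ)) ?_ ?_ ?_ ?_
  · intro i hi; rw [Finset.mem_range] at hi; rw [Finset.mem_Icc]; omega
  · intro i _ j _ h; exact_mod_cast h
  · intro x hx
    rw [Finset.mem_Icc] at hx
    exact ⟨x.toNat, by rw [Finset.mem_range]; omega, by omega⟩
  · intro i _; rfl

/-- The indicator function of a point. -/
def pointFn (y : ℤ) (z : ℤ) : ℝ := if z = y then 1 else 0

theorem sum_mul_pointFn {N : ℕ} (φ : ℤ → ℝ) {p : ℤ} (hp : p ∈ Finset.Icc (0 : ℤ) N) :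
    ∑ y ∈ Finset.Icc (0 : ℤ) N, φ y * pointFn y p = φ p := by
  simp only [pointFn, mul_ite, mul_one, mul_zero]
  rw [Finset.sum_ite_eq, if_pos hp]

/-- Stopped jumps stay in `{0, …, N}`, so the operator has a matrix there, with entries `jumpOp N m
b (pointFn y) x`. -/
theorem jumpOp_eq_sum {N : ℕ} (m : ℕ) (b : ℕ → ℝ) (φ : ℤ → ℝ) {x : ℤ}
    (hx : x ∈ Finset.Icc (0 : ℤ) N) :
    jumpOp N m b φ x = ∑ y ∈ Finset.Icc (0 : ℤ) N, φ y * jumpOp N m b (pointFn y) x := by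
  simp only [jumpOp, Finset.mul_sum]
  rw [Finset.sum_comm]
  refine Finset.sum_congr rfl fun k _ => ?_
  rw [Finset.mem_Icc] at hx
  have h1 := sum_mul_pointFn (N := N) φ (p := min (x + k) N) (by rw [Finset.mem_Icc]; omega)
  have h2 := sum_mul_pointFn (N := N) φ (p := max (x - k) 0) (by rw [Finset.mem_Icc]; omega)
  have h3 := sum_mul_pointFn (N := N) φ (p := x) (by rw [Finset.mem_Icc]; omega)
  rw [← h1, ← h2, ← h3, Finset.mul_sum, ← Finset.sum_add_distrib, ← Finset.sum_sub_distrib,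
    Finset.mul_sum]
  exact Finset.sum_congr rfl fun y _ => by ring

theorem sum_jumpOp_pointFn {N : ℕ} (m : ℕ) (b : ℕ → ℝ) {x : ℤ}
    (hx : x ∈ Finset.Icc (0 : ℤ) N) :
    ∑ y ∈ Finset.Icc (0 : ℤ) N, jumpOp N m b (pointFn y) x = 0 := by
  have h := jumpOp_eq_sum m b (fun _ => 1) hx
  simp only [one_mul] at h
  rw [← h, jumpOp]
  exact Finset.sum_eq_zero fun k _ => by ring

/-- The reflection exchanges the two walls. It transfers facts from the left end to the right end.
-/
theorem jumpOp_pointFn_reflect (N m : ℕ) (b : ℕ → ℝ) (x y : ℤ) :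
    jumpOp N m b (pointFn (N - y)) (N - x) = jumpOp N m b (pointFn y) x := by
  simp only [jumpOp]
  refine Finset.sum_congr rfl fun k _ => ?_
  have h1 : pointFn (N - y) (min (N - x + k) N) = pointFn y (max (x - k) 0) := by
    simp only [pointFn]; congr 1; rw [eq_iff_iff]; omega
  have h2 : pointFn (N - y) (max (N - x - k) 0) = pointFn y (min (x + k) N) := by
    simp only [pointFn]; congr 1; rw [eq_iff_iff]; omega
  have h3 : pointFn (N - y) (N - x) = pointFn y x := by
    simp only [pointFn]; congr 1; rw [eq_iff_iff]; omega
  rw [h1, h2, h3]; ring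

theorem jumpOp_pointFn_nonneg (N : ℕ) {m : ℕ} {b : ℕ → ℝ} (hb : ∀ k ∈ Finset.Icc 1 m, 0 ≤ b k)
    {x y : ℤ} (hxy : x ≠ y) : 0 ≤ jumpOp N m b (pointFn y) x := by
  refine Finset.sum_nonneg fun k hk => mul_nonneg (hb k hk) ?_
  simp only [pointFn, if_neg hxy]
  split_ifs <;> norm_num

theorem le_jumpOp_pointFn_succ {N m : ℕ} (hm : 1 ≤ m) {b : ℕ → ℝ}
    (hb : ∀ k ∈ Finset.Icc 1 m, 0 ≤ b k) {x : ℤ} (hx : x + 1 ≤ N) :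
    b 1 ≤ jumpOp N m b (pointFn (x + 1)) x := by
  have h1 : ∀ k ∈ Finset.Icc 1 m, 0 ≤ b k * (pointFn (x + 1) (min (x + k) N)
      + pointFn (x + 1) (max (x - k) 0) - 2 * pointFn (x + 1) x) := by
    refine fun k hk => mul_nonneg (hb k hk) ?_
    simp only [pointFn, if_neg (show x ≠ x + 1 by omega)]
    split_ifs <;> norm_num
  have h1m : 1 ∈ Finset.Icc 1 m := by simp [hm]
  refine le_trans ?_ (Finset.single_le_sum h1 h1m)
  have h2 : pointFn (x + 1) (min (x + (1 : ℕ)) N) = 1 := by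
    rw [pointFn, if_pos (by push_cast; omega)]
  have h3 : pointFn (x + 1) x = 0 := by rw [pointFn, if_neg (by omega)]
  have h4 : 0 ≤ pointFn (x + 1) (max (x - (1 : ℕ)) 0) := by rw [pointFn]; split_ifs <;> norm_num
  rw [h2, h3]
  nlinarith [hb 1 h1m]

theorem le_jumpOp_pointFn_pred {N m : ℕ} (hm : 1 ≤ m) {b : ℕ → ℝ}
    (hb : ∀ k ∈ Finset.Icc 1 m, 0 ≤ b k) {x : ℤ} (hx : 0 ≤ x) :
    b 1 ≤ jumpOp N m b (pointFn x) (x + 1) := by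
  have h := le_jumpOp_pointFn_succ (N := N) hm hb (x := N - x - 1) (by omega)
  rw [← jumpOp_pointFn_reflect] at h
  convert h using 3 <;> ring

/-- In the interior, the adjoint of the jump operator is the free jump operator acting on the
extension by zero. -/
theorem sum_mul_jumpOp_pointFn_of_interior {N : ℕ} (m : ℕ) (b : ℕ → ℝ) {w : ℤ → ℝ}
    (hw : ∀ z, z ∉ Finset.Icc (0 : ℤ) N → w z = 0) {y : ℤ} (hy : y ∈ Finset.Icc (1 : ℤ) (N - 1)) :
    ∑ x ∈ Finset.Icc (0 : ℤ) N, w x * jumpOp N m b (pointFn y) x = freeJumpOp m b w y := by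
  rw [Finset.mem_Icc] at hy
  simp only [jumpOp, freeJumpOp, Finset.mul_sum]
  rw [Finset.sum_comm]
  refine Finset.sum_congr rfl fun k _ => ?_
  have key : ∀ p : ℤ, ∑ x ∈ Finset.Icc (0 : ℤ) N, (if x = p then w x else 0) = w p := by
    intro p
    rw [Finset.sum_ite_eq']
    split_ifs with h
    · rfl
    · exact (hw p h).symm
  rw [← key (y + k), ← key (y - k), ← key y, ← Finset.sum_add_distrib, Finset.mul_sum,
    ← Finset.sum_sub_distrib, Finset.mul_sum]
  refine Finset.sum_congr rfl fun x hx => ?_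
  rw [Finset.mem_Icc] at hx
  -- A jump that is cut short lands on `0` or `N`, never on an interior `y`.
  have h1 : (min (x + k) (N : ℤ) = y) ↔ x = y - k := by omega
  have h2 : (max (x - k) (0 : ℤ) = y) ↔ x = y + k := by omega
  simp only [pointFn, h1, h2]
  split_ifs <;> ring

/-- The matrix of the Robin generator. -/
noncomputable def robinMatrix (N m : ℕ) (b : ℕ → ℝ) (Aminus Aplus : ℝ) :
    Matrix (Fin (N + 1)) (Fin (N + 1)) ℝ := fun i j =>
  (N : ℝ) ^ 2 * jumpOp N m b (pointFn ((j : ℕ) : ℤ)) ((i : ℕ) : ℤ)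
    - (if i = j then (if i = 0 then N * Aminus else 0) + (if i = Fin.last N then N * Aplus else 0)
      else 0)

theorem mem_Icc_of_fin {N : ℕ} (i : Fin (N + 1)) : ((i : ℕ) : ℤ) ∈ Finset.Icc (0 : ℤ) N := by
  rw [Finset.mem_Icc]; have := i.2; omega

theorem robinMatrix_mulVec (N m : ℕ) (b : ℕ → ℝ) (Aminus Aplus : ℝ) (φ : ℤ → ℝ)
    (i : Fin (N + 1)) :
    (robinMatrix N m b Aminus Aplus).mulVec (fun j => φ ((j : ℕ) : ℤ)) i
      = (N : ℝ) ^ 2 * jumpOp N m b φ ((i : ℕ) : ℤ)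
        - ((if i = 0 then N * Aminus else 0) + (if i = Fin.last N then N * Aplus else 0))
          * φ ((i : ℕ) : ℤ) := by
  rw [jumpOp_eq_sum m b φ (mem_Icc_of_fin i), ← sum_fin_eq_sum_Icc, Finset.mul_sum, Matrix.mulVec,
    dotProduct]
  simp only [robinMatrix, sub_mul, Finset.sum_sub_distrib, ite_mul, zero_mul, Finset.sum_ite_eq,
    Finset.mem_univ, if_true]
  congr 1
  · exact Finset.sum_congr rfl fun j _ => by ring

theorem robinMatrix_transpose_mulVec (N m : ℕ) (b : ℕ → ℝ) (Aminus Aplus : ℝ) (w : ℤ → ℝ)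
    (j : Fin (N + 1)) :
    (robinMatrix N m b Aminus Aplus).transpose.mulVec (fun i => w ((i : ℕ) : ℤ)) j
      = (N : ℝ) ^ 2 *
          ∑ x ∈ Finset.Icc (0 : ℤ) N, w x * jumpOp N m b (pointFn ((j : ℕ) : ℤ)) x
        - ((if j = 0 then N * Aminus else 0) + (if j = Fin.last N then N * Aplus else 0))
          * w ((j : ℕ) : ℤ) := by
  rw [← sum_fin_eq_sum_Icc, Finset.mul_sum, Matrix.mulVec, dotProduct]
  simp only [Matrix.transpose_apply, robinMatrix, sub_mul, Finset.sum_sub_distrib, ite_mul,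
    zero_mul, Finset.sum_ite_eq', Finset.mem_univ, if_true]
  congr 1
  · exact Finset.sum_congr rfl fun j _ => by ring

/-- No sign of `b` is assumed: this serves the small `N`. The factor `4` counts the two targets of a
jump and the weight two of the diagonal. -/
theorem sum_abs_robinMatrix_le (N m : ℕ) {b : ℕ → ℝ} (Aminus Aplus : ℝ) {B : ℝ}
    (hB : ∑ k ∈ Finset.Icc 1 m, |b k| ≤ B) (i : Fin (N + 1)) :
    ∑ j, |robinMatrix N m b Aminus Aplus i j| ≤
      (N : ℝ) ^ 2 * (4 * B) + N * (|Aminus| + |Aplus|) := by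
  have h1 : ∀ j, |robinMatrix N m b Aminus Aplus i j| ≤
      (N : ℝ) ^ 2 * (∑ k ∈ Finset.Icc 1 m, |b k| *
        (pointFn ((j : ℕ) : ℤ) (min (((i : ℕ) : ℤ) + k) N)
          + pointFn ((j : ℕ) : ℤ) (max (((i : ℕ) : ℤ) - k) 0)
          + 2 * pointFn ((j : ℕ) : ℤ) ((i : ℕ) : ℤ)))
      + (if i = j then N * (|Aminus| + |Aplus|) else 0) := by
    intro j
    rw [robinMatrix]
    rw [sub_eq_add_neg]
    refine (abs_add_le _ _).trans (add_le_add ?_ ?_)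
    · rw [abs_mul, abs_of_nonneg (by positivity : (0 : ℝ) ≤ (N : ℝ) ^ 2)]
      refine mul_le_mul_of_nonneg_left ?_ (by positivity)
      refine (Finset.abs_sum_le_sum_abs _ _).trans (Finset.sum_le_sum fun k _ => ?_)
      rw [abs_mul]
      refine mul_le_mul_of_nonneg_left ?_ (abs_nonneg _)
      simp only [pointFn]
      split_ifs <;> norm_num
    · rw [abs_neg]
      by_cases hij : i = j
      · rw [if_pos hij, if_pos hij, mul_add]
        refine (abs_add_le _ _).trans (add_le_add ?_ ?_)
        all_goals
          split_ifs
          · rw [abs_mul, Nat.abs_cast]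
          · rw [abs_zero]; positivity
      · simp [hij]
  refine (Finset.sum_le_sum fun j _ => h1 j).trans ?_
  rw [Finset.sum_add_distrib, ← Finset.mul_sum, Finset.sum_ite_eq, if_pos (Finset.mem_univ i),
    Finset.sum_comm]
  refine add_le_add (mul_le_mul_of_nonneg_left ?_ (by positivity)) le_rfl
  have h2 : ∀ p ∈ Finset.Icc (0 : ℤ) N, ∑ j : Fin (N + 1), pointFn ((j : ℕ) : ℤ) p = 1 := by
    intro p hp
    rw [sum_fin_eq_sum_Icc N (fun y => pointFn y p)]
    simpa using sum_mul_pointFn (fun _ => 1) hp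
  have hi := mem_Icc_of_fin i
  calc _ = ∑ k ∈ Finset.Icc 1 m, |b k| * 4 := by
        refine Finset.sum_congr rfl fun k _ => ?_
        rw [← Finset.mul_sum, Finset.sum_add_distrib, Finset.sum_add_distrib, ← Finset.mul_sum,
          h2 _ hi, h2, h2]
        · norm_num
        · rw [Finset.mem_Icc] at hi ⊢; omega
        · rw [Finset.mem_Icc] at hi ⊢; omega
    _ ≤ 4 * B := by rw [← Finset.sum_mul]; linarith

end JumpOperator

/-! ### The supersolution of the transposed generator. -/

section LeftWeight

/-- Weak maximum principle for the free jump operator with a positive potential. -/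
theorem nonpos_of_mul_le_freeJumpOp {m : ℕ} {b : ℕ → ℝ} (hb : ∀ k ∈ Finset.Icc 1 m, 0 ≤ b k)
    {r : ℝ} (hr : 0 < r) {u : ℤ → ℝ} {p q : ℤ} (hout : ∀ y, y ∉ Finset.Icc p q → u y ≤ 0)
    (hin : ∀ y ∈ Finset.Icc p q, r * u y ≤ freeJumpOp m b u y) (z : ℤ) : u z ≤ 0 := by
  by_contra hz
  push Not at hz
  have hzI : z ∈ Finset.Icc p q := by
    by_contra h; exact absurd (hout z h) (not_le.2 hz)
  obtain ⟨y, hy, hmax⟩ := Finset.exists_max_image (Finset.Icc p q) u ⟨z, hzI⟩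
  have hpos : 0 < u y := hz.trans_le (hmax z hzI)
  have hall : ∀ x, u x ≤ u y := by
    intro x
    by_cases hx : x ∈ Finset.Icc p q
    · exact hmax x hx
    · exact (hout x hx).trans hpos.le
  have h1 : freeJumpOp m b u y ≤ 0 := by
    refine Finset.sum_nonpos fun k hk => mul_nonpos_of_nonneg_of_nonpos (hb k hk) ?_
    have := hall (y + k)
    have := hall (y - k)
    linarith
  have h2 := hin y hy
  have := mul_pos hr hpos
  linarith

theorem freeJumpOp_neg (m : ℕ) (b : ℕ → ℝ) (u : ℤ → ℝ) (y : ℤ) :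
    freeJumpOp m b (fun z => -u z) y = -freeJumpOp m b u y := by
  simp only [freeJumpOp]
  rw [← Finset.sum_neg_distrib]
  exact Finset.sum_congr rfl fun k _ => by ring

/-- Extension by zero of a function on `{0, …, N}`. -/
noncomputable def zeroExt {N : ℕ} (v : Fin (N + 1) → ℝ) (z : ℤ) : ℝ :=
  if z ∈ Finset.Icc (0 : ℤ) N then v (Fin.ofNat (N + 1) z.toNat) else 0

theorem zeroExt_coe {N : ℕ} (v : Fin (N + 1) → ℝ) (i : Fin (N + 1)) :
    zeroExt v ((i : ℕ) : ℤ) = v i := by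
  rw [zeroExt, if_pos (mem_Icc_of_fin i)]
  simp

theorem zeroExt_eq_zero {N : ℕ} (v : Fin (N + 1) → ℝ) {z : ℤ} (hz : z ∉ Finset.Icc (0 : ℤ) N) :
    zeroExt v z = 0 := if_neg hz

theorem zeroExt_add {N : ℕ} (v w : Fin (N + 1) → ℝ) (z : ℤ) :
    zeroExt (v + w) z = zeroExt v z + zeroExt w z := by
  simp only [zeroExt, Pi.add_apply]; split_ifs <;> ring

theorem zeroExt_smul {N : ℕ} (c : ℝ) (v : Fin (N + 1) → ℝ) (z : ℤ) :
    zeroExt (c • v) z = c * zeroExt v z := by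
  simp only [zeroExt, Pi.smul_apply, smul_eq_mul]; split_ifs <;> ring

/-- The operator of the Dirichlet problem `freeJumpOp w = r w` in `{1, …, N - 1}`. -/
noncomputable def dirichletMap (N m : ℕ) (b : ℕ → ℝ) (r : ℝ) :
    (Fin (N + 1) → ℝ) →ₗ[ℝ] (Fin (N + 1) → ℝ) where
  toFun v i := if i = 0 ∨ i = Fin.last N then v i else
    freeJumpOp m b (zeroExt v) ((i : ℕ) : ℤ) - r * v i
  map_add' v w := by
    funext i
    have h : freeJumpOp m b (zeroExt (v + w)) ((i : ℕ) : ℤ)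
        = freeJumpOp m b (zeroExt v) ((i : ℕ) : ℤ) + freeJumpOp m b (zeroExt w) ((i : ℕ) : ℤ) := by
      simp only [freeJumpOp, zeroExt_add]
      rw [← Finset.sum_add_distrib]
      exact Finset.sum_congr rfl fun k _ => by ring
    simp only [h, Pi.add_apply]
    split_ifs <;> ring
  map_smul' c v := by
    funext i
    have h : freeJumpOp m b (zeroExt (c • v)) ((i : ℕ) : ℤ)
        = c * freeJumpOp m b (zeroExt v) ((i : ℕ) : ℤ) := by
      simp only [freeJumpOp, zeroExt_smul]
      rw [Finset.mul_sum]
      exact Finset.sum_congr rfl fun k _ => by ring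
    simp only [h, Pi.smul_apply, smul_eq_mul, RingHom.id_apply]
    split_ifs <;> ring

theorem interior_iff {N : ℕ} (i : Fin (N + 1)) :
    ((i : ℕ) : ℤ) ∈ Finset.Icc (1 : ℤ) (N - 1) ↔ ¬ (i = 0 ∨ i = Fin.last N) := by
  have := i.2
  rw [Finset.mem_Icc, Fin.ext_iff, Fin.ext_iff, Fin.val_last, Fin.val_zero]
  omega

theorem exists_fin_of_mem_Icc {N : ℕ} {y : ℤ} (hy : y ∈ Finset.Icc (0 : ℤ) N) :
    ∃ i : Fin (N + 1), ((i : ℕ) : ℤ) = y := by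
  rw [Finset.mem_Icc] at hy
  exact ⟨⟨y.toNat, by omega⟩, by simp only; omega⟩

/-- The maximum principle applies to both `v` and `-v`. In finite dimension injectivity then yields
solvability of the Dirichlet problem. -/
theorem dirichletMap_injective (N : ℕ) {m : ℕ} {b : ℕ → ℝ}
    (hb : ∀ k ∈ Finset.Icc 1 m, 0 ≤ b k) {r : ℝ} (hr : 0 < r) :
    Function.Injective (dirichletMap N m b r) := by
  rw [← LinearMap.ker_eq_bot, LinearMap.ker_eq_bot']
  intro v hv
  have hvi : ∀ i, (if i = 0 ∨ i = Fin.last N then v i else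
      freeJumpOp m b (zeroExt v) ((i : ℕ) : ℤ) - r * v i) = 0 := fun i => congrFun hv i
  have hout : ∀ y, y ∉ Finset.Icc (1 : ℤ) (N - 1) → zeroExt v y = 0 := by
    intro y hy
    by_cases h : y ∈ Finset.Icc (0 : ℤ) N
    · obtain ⟨i, rfl⟩ := exists_fin_of_mem_Icc h
      have h1 := hvi i
      rw [interior_iff, not_not] at hy
      rw [if_pos hy] at h1
      rw [zeroExt_coe, h1]
    · exact zeroExt_eq_zero v h
  have hin : ∀ y ∈ Finset.Icc (1 : ℤ) (N - 1), freeJumpOp m b (zeroExt v) y = r * zeroExt v y := by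
    intro y hy
    obtain ⟨i, rfl⟩ : ∃ i : Fin (N + 1), ((i : ℕ) : ℤ) = y := by
      refine exists_fin_of_mem_Icc ?_
      rw [Finset.mem_Icc] at hy ⊢; omega
    have h1 := hvi i
    rw [if_neg ((interior_iff i).1 hy)] at h1
    rw [zeroExt_coe]; linarith
  funext i
  have h1 := nonpos_of_mul_le_freeJumpOp hb hr (u := zeroExt v)
    (fun y hy => (hout y hy).le) (fun y hy => (hin y hy).ge) ((i : ℕ) : ℤ)
  have h2 := nonpos_of_mul_le_freeJumpOp hb hr (u := fun z => -zeroExt v z)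
    (fun y hy => by rw [hout y hy, neg_zero])
    (fun y hy => by rw [freeJumpOp_neg, hin y hy]; linarith) ((i : ℕ) : ℤ)
  rw [zeroExt_coe] at h1 h2
  exact le_antisymm h1 (neg_nonpos.1 h2)

/-- Reflection-symmetric solution of the Dirichlet problem for the free jump operator with a
positive potential, equal to one at both ends of `{0, …, N}`. -/
theorem exists_dirichlet_solution (N : ℕ) {m : ℕ} {b : ℕ → ℝ}
    (hb : ∀ k ∈ Finset.Icc 1 m, 0 ≤ b k) {r : ℝ} (hr : 0 < r) :
    ∃ w : ℤ → ℝ, (∀ z, z ∉ Finset.Icc (0 : ℤ) N → w z = 0) ∧ w 0 = 1 ∧ w N = 1 ∧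
      (∀ z, w (N - z) = w z) ∧
      ∀ y ∈ Finset.Icc (1 : ℤ) (N - 1), freeJumpOp m b w y = r * w y := by
  obtain ⟨v, hv⟩ := LinearMap.injective_iff_surjective.1 (dirichletMap_injective N hb hr)
    (fun i => if i = 0 ∨ i = Fin.last N then 1 else 0)
  have hvi : ∀ i, (if i = 0 ∨ i = Fin.last N then v i else
      freeJumpOp m b (zeroExt v) ((i : ℕ) : ℤ) - r * v i)
      = if i = 0 ∨ i = Fin.last N then 1 else 0 := fun i => congrFun hv i
  have h0 : zeroExt v 0 = 1 := by
    have := hvi 0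
    rw [if_pos (Or.inl rfl), if_pos (Or.inl rfl), ← zeroExt_coe v 0] at this
    simpa using this
  have hN : zeroExt v N = 1 := by
    have := hvi (Fin.last N)
    rw [if_pos (Or.inr rfl), if_pos (Or.inr rfl), ← zeroExt_coe v (Fin.last N)] at this
    simpa using this
  have hin : ∀ y ∈ Finset.Icc (1 : ℤ) (N - 1), freeJumpOp m b (zeroExt v) y = r * zeroExt v y := by
    intro y hy
    obtain ⟨i, rfl⟩ : ∃ i : Fin (N + 1), ((i : ℕ) : ℤ) = y := by
      refine exists_fin_of_mem_Icc ?_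
      rw [Finset.mem_Icc] at hy ⊢; omega
    have h1 := hvi i
    rw [if_neg ((interior_iff i).1 hy), if_neg ((interior_iff i).1 hy)] at h1
    rw [zeroExt_coe]; linarith
  -- Averaging a solution with its reflection makes it symmetric.
  refine ⟨fun z => (zeroExt v z + zeroExt v (N - z)) / 2, ?_, ?_, ?_, ?_, ?_⟩
  · intro z hz
    have hz' : (N : ℤ) - z ∉ Finset.Icc (0 : ℤ) N := by
      rw [Finset.mem_Icc] at hz ⊢; omega
    simp only
    rw [zeroExt_eq_zero v hz, zeroExt_eq_zero v hz']; norm_num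
  · simp only [sub_zero]; rw [h0, hN]; norm_num
  · simp only [sub_self]; rw [h0, hN]; norm_num
  · intro z; simp only [sub_sub_cancel]; ring
  · intro y hy
    have h1 := hin y hy
    have h2 := hin (N - y) (by rw [Finset.mem_Icc] at hy ⊢; omega)
    have h3 : freeJumpOp m b (fun z => (zeroExt v z + zeroExt v (N - z)) / 2) y
        = (freeJumpOp m b (zeroExt v) y + freeJumpOp m b (zeroExt v) (N - y)) / 2 := by
      simp only [freeJumpOp]
      rw [← Finset.sum_add_distrib, Finset.sum_div]
      refine Finset.sum_congr rfl fun k _ => ?_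
      rw [show (N : ℤ) - (y + k) = N - y - k by ring, show (N : ℤ) - (y - k) = N - y + k by ring]
      ring
    rw [h3, h1, h2]; ring

/-- The hyperbolic cosine profile centred in `{0, …, N}`. -/
noncomputable def coshFn (N : ℕ) (θ : ℝ) (x : ℤ) : ℝ := Real.cosh (θ * ((x : ℝ) / N - 1 / 2))

theorem coshFn_pos (N : ℕ) (θ : ℝ) (x : ℤ) : 0 < coshFn N θ x := Real.cosh_pos _

theorem one_le_coshFn (N : ℕ) (θ : ℝ) (x : ℤ) : 1 ≤ coshFn N θ x := Real.one_le_cosh _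

theorem coshFn_reflect {N : ℕ} (hN : 1 ≤ N) (θ : ℝ) (x : ℤ) :
    coshFn N θ (N - x) = coshFn N θ x := by
  have hN0 : (N : ℝ) ≠ 0 := by positivity
  rw [coshFn, coshFn, ← Real.cosh_neg]
  congr 1
  push_cast
  field_simp
  ring

theorem coshFn_le {N : ℕ} (hN : 1 ≤ N) {θ : ℝ} (hθ : 0 ≤ θ) {x : ℤ}
    (hx : x ∈ Finset.Icc (0 : ℤ) N) : coshFn N θ x ≤ Real.cosh (θ / 2) := by
  have hN0 : (0 : ℝ) < N := by positivity
  rw [Finset.mem_Icc] at hx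
  have h1 : (0 : ℝ) ≤ x := by exact_mod_cast hx.1
  have h2 : (x : ℝ) ≤ N := by exact_mod_cast hx.2
  have h3 : (x : ℝ) / N ≤ 1 := (div_le_one hN0).2 h2
  have h4 : 0 ≤ (x : ℝ) / N := by positivity
  rw [coshFn, Real.cosh_le_cosh, div_eq_mul_one_div θ 2, abs_mul, abs_mul, abs_of_nonneg hθ]
  refine mul_le_mul_of_nonneg_left ?_ hθ
  rw [abs_of_nonneg (by norm_num : (0 : ℝ) ≤ 1 / 2), abs_le]
  constructor <;> linarith

/-- The profile is an eigenfunction of every symmetric second difference. -/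
theorem coshFn_add_add_sub (N : ℕ) (θ : ℝ) (x : ℤ) (k : ℕ) :
    coshFn N θ (x + k) + coshFn N θ (x - k) - 2 * coshFn N θ x
      = coshFn N θ x * (2 * (Real.cosh (θ * k / N) - 1)) := by
  have h1 : θ * (((x + (k : ℤ) : ℤ) : ℝ) / N - 1 / 2)
      = θ * ((x : ℝ) / N - 1 / 2) + θ * k / N := by push_cast; ring
  have h2 : θ * (((x - (k : ℤ) : ℤ) : ℝ) / N - 1 / 2)
      = θ * ((x : ℝ) / N - 1 / 2) - θ * k / N := by push_cast; ring
  rw [coshFn, coshFn, coshFn, h1, h2, Real.cosh_add, Real.cosh_sub]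
  ring

theorem one_add_sq_div_two_le_cosh (z : ℝ) : 1 + z ^ 2 / 2 ≤ Real.cosh z := by
  have h := sum_le_hasSum (Finset.range 2)
    (fun n _ => div_nonneg ((even_two_mul n).pow_nonneg z) (Nat.cast_nonneg _))
    (Real.hasSum_cosh z)
  simpa [Finset.sum_range_succ] using h

/-- Every jump length contributes a nonnegative amount; the term `k = 1` alone suffices. This makes
the profile a subsolution of the Dirichlet problem. -/
theorem mul_coshFn_le_freeJumpOp {m : ℕ} (hm : 1 ≤ m) {b : ℕ → ℝ}
    (hb : ∀ k ∈ Finset.Icc 1 m, 0 ≤ b k) {c : ℝ} (hc : c ≤ b 1) (N : ℕ) (θ : ℝ) (x : ℤ) :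
    c * (θ / N) ^ 2 * coshFn N θ x ≤ freeJumpOp m b (coshFn N θ) x := by
  have h1 : ∀ k ∈ Finset.Icc 1 m, 0 ≤ b k *
      (coshFn N θ (x + k) + coshFn N θ (x - k) - 2 * coshFn N θ x) := by
    intro k hk
    rw [coshFn_add_add_sub]
    refine mul_nonneg (hb k hk) (mul_nonneg (coshFn_pos N θ x).le ?_)
    linarith [Real.one_le_cosh (θ * k / N)]
  have h1m : 1 ∈ Finset.Icc 1 m := by simp [hm]
  refine le_trans ?_ (Finset.single_le_sum h1 h1m)
  rw [coshFn_add_add_sub]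
  have h2 := one_add_sq_div_two_le_cosh (θ * (1 : ℕ) / N)
  rw [Nat.cast_one, mul_one] at h2 ⊢
  have h3 : (θ / N) ^ 2 ≤ 2 * (Real.cosh (θ / N) - 1) := by linarith
  have h4 := mul_le_mul hc h3 (sq_nonneg _) (hb 1 h1m)
  have h5 := mul_le_mul_of_nonneg_right h4 (coshFn_pos N θ x).le
  linarith

/-- Bounds for the solution of the Dirichlet problem, uniform in `N`. -/
theorem dirichlet_solution_bounds {N m : ℕ} (hm : 1 ≤ m) (hN : 2 * m ≤ N + 1) {b : ℕ → ℝ}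
    (hb : ∀ k ∈ Finset.Icc 1 m, 0 ≤ b k) {c L : ℝ} (hc0 : 0 < c) (hc : c ≤ b 1)
    (hL : ∑ k ∈ Finset.Icc 1 m, b k ≤ L) {θ : ℝ} (hθ : 0 < θ) {r : ℝ}
    (hr : r = c * (θ / N) ^ 2) (hr1 : r ≤ 1) {w : ℤ → ℝ}
    (hout : ∀ z, z ∉ Finset.Icc (0 : ℤ) N → w z = 0) (h0 : w 0 = 1) (hwN : w N = 1)
    (hsymm : ∀ z, w (N - z) = w z)
    (hin : ∀ y ∈ Finset.Icc (1 : ℤ) (N - 1), freeJumpOp m b w y = r * w y) :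
    (∀ y, w y ≤ 1) ∧ ∀ y ∈ Finset.Icc (0 : ℤ) N,
      (c / (2 * L + 1)) ^ m * (coshFn N θ y / Real.cosh (θ / 2)) ≤ w y := by
  have hN1 : 1 ≤ N := by omega
  have hN0 : (0 : ℝ) < N := by positivity
  have hr0 : 0 < r := by rw [hr]; positivity
  have hbdry : ∀ y, y ∉ Finset.Icc (1 : ℤ) (N - 1) → w y = 0 ∨ w y = 1 := by
    intro y hy
    by_cases h : y ∈ Finset.Icc (0 : ℤ) N
    · right
      rw [Finset.mem_Icc] at h hy
      obtain h | h : y = 0 ∨ y = N := by omega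
      · rw [h, h0]
      · rw [h, hwN]
    · exact Or.inl (hout y h)
  have hnn : ∀ y, 0 ≤ w y := by
    intro y
    have := nonpos_of_mul_le_freeJumpOp hb hr0 (u := fun z => -w z) (p := 1) (q := N - 1)
      (fun y hy => by rcases hbdry y hy with h | h <;> simp [h])
      (fun y hy => by rw [freeJumpOp_neg, hin y hy]; linarith) y
    linarith
  have hle : ∀ y, w y ≤ 1 := by
    intro y
    have := nonpos_of_mul_le_freeJumpOp hb hr0 (u := fun z => w z - 1) (p := 1) (q := N - 1)
      (fun y hy => by rcases hbdry y hy with h | h <;> simp [h])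
      (fun y hy => by
        have : freeJumpOp m b (fun z => w z - 1) y = freeJumpOp m b w y :=
          Finset.sum_congr rfl fun k _ => by ring
        rw [this, hin y hy]; linarith) y
    linarith
  refine ⟨hle, ?_⟩
  have h1m : 1 ∈ Finset.Icc 1 m := by simp [hm]
  have hcL : c ≤ L := hc.trans ((Finset.single_le_sum hb h1m).trans hL)
  set ε : ℝ := c / (2 * L + 1) with hε
  have hden : 0 < 2 * L + 1 := by linarith
  have hε0 : 0 < ε := by positivity
  have hε1 : ε ≤ 1 := by rw [hε, div_le_one hden]; linarith
  -- A one-step Harnack inequality: the equation reads `∑ b k (w (y + k) + w (y - k)) = (r + 2 ∑ b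
  -- k) w y`, where the right factor is at most `2 * L + 1`.
  have hstep : ∀ y ∈ Finset.Icc (1 : ℤ) (N - 1), ε * w (y - 1) ≤ w y := by
    intro y hy
    have h1 := hin y hy
    have h2 : b 1 * w (y - 1) ≤ ∑ k ∈ Finset.Icc 1 m, b k * (w (y + k) + w (y - k)) := by
      have h3 := Finset.single_le_sum (f := fun k : ℕ => b k * (w (y + k) + w (y - k)))
        (fun k hk => mul_nonneg (hb k hk) (add_nonneg (hnn _) (hnn _))) h1m
      simp only [Nat.cast_one] at h3
      have h4 := mul_nonneg (hb 1 h1m) (hnn (y + 1))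
      linarith
    have h3 : freeJumpOp m b w y = ∑ k ∈ Finset.Icc 1 m, b k * (w (y + k) + w (y - k))
        - 2 * (∑ k ∈ Finset.Icc 1 m, b k) * w y := by
      rw [freeJumpOp, mul_assoc, Finset.sum_mul, Finset.mul_sum, ← Finset.sum_sub_distrib]
      exact Finset.sum_congr rfl fun k _ => by ring
    have h4 := mul_le_mul_of_nonneg_right hL (hnn y)
    have h5 := mul_le_mul_of_nonneg_right hc (hnn (y - 1))
    have h6 := mul_le_mul_of_nonneg_right hr1 (hnn y)
    rw [hε, div_mul_eq_mul_div, div_le_iff₀ hden]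
    linarith
  have hchain : ∀ n : ℕ, n ≤ m - 1 → ε ^ n ≤ w n := by
    intro n
    induction n with
    | zero => intro _; simp [h0]
    | succ n ih =>
      intro hn
      have h1 := hstep ((n : ℤ) + 1) (by rw [Finset.mem_Icc]; omega)
      rw [add_sub_cancel_right] at h1
      have h2 := mul_le_mul_of_nonneg_left (ih (by omega)) hε0.le
      rw [pow_succ, Nat.cast_add, Nat.cast_one]
      linarith
  have hchain' : ∀ y : ℤ, 0 ≤ y → y ≤ m - 1 → ε ^ m ≤ w y := by
    intro y hy0 hy
    have h1 := hchain y.toNat (by omega)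
    rw [Int.toNat_of_nonneg hy0] at h1
    exact (pow_le_pow_of_le_one hε0.le hε1 (by omega)).trans h1
  -- With this `ρ` the cosine profile is at most `ε ^ m` everywhere, hence lies below `w` on the two
  -- boundary layers of width `m`. Between them jumps do not leave `{0, …, N}`, so the maximum
  -- principle compares the two functions without seeing the extension by zero.
  set ρ : ℝ := ε ^ m / Real.cosh (θ / 2) with hρ
  have hcosh : 0 < Real.cosh (θ / 2) := Real.cosh_pos _
  have hρ0 : 0 < ρ := by positivity
  let s : ℤ → ℝ := fun y => if y ∈ Finset.Icc (0 : ℤ) N then ρ * coshFn N θ y - w y else 0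
  have hs : ∀ y ∈ Finset.Icc (0 : ℤ) N, s y = ρ * coshFn N θ y - w y := fun y hy => if_pos hy
  have hρle : ∀ y ∈ Finset.Icc (0 : ℤ) N, ρ * coshFn N θ y ≤ ε ^ m := by
    intro y hy
    have := mul_le_mul_of_nonneg_left (coshFn_le hN1 hθ.le hy) hρ0.le
    rwa [hρ, div_mul_cancel₀ _ hcosh.ne'] at this
  have hmain := nonpos_of_mul_le_freeJumpOp hb hr0 (u := s) (p := m) (q := N - m)
    (by
      intro y hy
      by_cases h : y ∈ Finset.Icc (0 : ℤ) N
      · rw [hs y h, sub_nonpos]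
        refine (hρle y h).trans ?_
        rw [Finset.mem_Icc] at h hy
        by_cases hym : y ≤ m - 1
        · exact hchain' y h.1 hym
        · rw [← hsymm]
          exact hchain' _ (by omega) (by omega)
      · simp only [s]; rw [if_neg h])
    (by
      intro y hy
      rw [Finset.mem_Icc] at hy
      have hyI : y ∈ Finset.Icc (0 : ℤ) N := by rw [Finset.mem_Icc]; omega
      have h1 : freeJumpOp m b s y = ρ * freeJumpOp m b (coshFn N θ) y - freeJumpOp m b w y := by
        rw [freeJumpOp, freeJumpOp, freeJumpOp, Finset.mul_sum, ← Finset.sum_sub_distrib]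
        refine Finset.sum_congr rfl fun k hk => ?_
        rw [Finset.mem_Icc] at hk
        rw [hs y hyI, hs (y + k) (by rw [Finset.mem_Icc]; omega),
          hs (y - k) (by rw [Finset.mem_Icc]; omega)]
        ring
      have h2 := mul_le_mul_of_nonneg_left (mul_coshFn_le_freeJumpOp hm hb hc N θ y) hρ0.le
      rw [h1, hs y hyI, hin y (by rw [Finset.mem_Icc]; omega), hr]
      linarith)
  intro y hy
  have h1 := hmain y
  rw [hs y hy] at h1
  have h2 : ε ^ m * (coshFn N θ y / Real.cosh (θ / 2)) = ρ * coshFn N θ y := by rw [hρ]; ring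
  linarith

/-- The mass of the normalised hyperbolic cosine profile in `{1, …, N - 1}`. -/
theorem le_sum_coshFn {N q : ℕ} (hq : 2 ≤ q) (hN : q ≤ N) :
    (N : ℝ) / (12 * q) ≤
      ∑ y ∈ Finset.Icc (1 : ℤ) (N - 1), coshFn N q y / Real.cosh ((q : ℝ) / 2) := by
  have hq0 : (0 : ℝ) < q := by positivity
  have hN1 : 1 ≤ N := by omega
  have hN0 : (0 : ℝ) < N := by positivity
  have hdiv1 : 1 ≤ N / q := (Nat.one_le_div_iff (by omega)).2 hN
  have hdiv2 : N / q ≤ N / 2 := Nat.div_le_div_left hq (by norm_num)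
  have hdivq : N / q * q ≤ N := Nat.div_mul_le_self N q
  have hsub : Finset.Icc (1 : ℤ) (N / q : ℕ) ⊆ Finset.Icc (1 : ℤ) (N - 1) := by
    refine Finset.Icc_subset_Icc le_rfl ?_
    omega
  have hcosh : 0 < Real.cosh ((q : ℝ) / 2) := Real.cosh_pos _
  refine le_trans ?_ (Finset.sum_le_sum_of_subset_of_nonneg hsub
    fun y _ _ => div_nonneg (coshFn_pos _ _ _).le hcosh.le)
  -- For `y ≤ N / q` the exponent drops by at most one from its boundary value, so the ratio is at
  -- least `1 / (2 e) > 1 / 6`. The number of such points is at least `N / (2 q)`.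
  have hterm : ∀ y ∈ Finset.Icc (1 : ℤ) (N / q : ℕ),
      (1 / 6 : ℝ) ≤ coshFn N q y / Real.cosh ((q : ℝ) / 2) := by
    intro y hy
    rw [Finset.mem_Icc] at hy
    rw [le_div_iff₀ hcosh]
    have h1 : (q : ℝ) * ((y : ℝ) / N) ≤ 1 := by
      have h2 := (Int.cast_le (R := ℝ)).2 hy.2
      rw [Int.cast_natCast] at h2
      have h3 : ((N / q : ℕ) : ℝ) * q ≤ N := by exact_mod_cast hdivq
      rw [mul_div_assoc', div_le_one hN0]
      nlinarith
    have h2 : Real.cosh ((q : ℝ) / 2) ≤ Real.exp ((q : ℝ) / 2) := by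
      rw [Real.cosh_eq]
      have : Real.exp (-((q : ℝ) / 2)) ≤ Real.exp ((q : ℝ) / 2) :=
        Real.exp_le_exp.2 (by linarith)
      linarith
    have h3 : Real.exp ((q : ℝ) / 2 - 1) / 2 ≤ coshFn N q y := by
      rw [coshFn, ← Real.cosh_neg, Real.cosh_eq]
      have h4 : Real.exp ((q : ℝ) / 2 - 1) ≤ Real.exp (-((q : ℝ) * ((y : ℝ) / N - 1 / 2))) :=
        Real.exp_le_exp.2 (by linarith)
      have := Real.exp_pos (- -((q : ℝ) * ((y : ℝ) / N - 1 / 2)))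
      linarith
    have h4 : Real.exp ((q : ℝ) / 2) = Real.exp 1 * Real.exp ((q : ℝ) / 2 - 1) := by
      rw [← Real.exp_add]; congr 1; ring
    have h5 := Real.exp_one_lt_d9
    have h6 := Real.exp_pos ((q : ℝ) / 2 - 1)
    nlinarith
  have hcard := Finset.card_nsmul_le_sum _ _ _ hterm
  rw [Int.card_Icc, nsmul_eq_mul] at hcard
  refine le_trans ?_ hcard
  have h1 : ((((N / q : ℕ) : ℤ) + 1 - 1).toNat : ℝ) = ((N / q : ℕ) : ℝ) := by
    rw [add_sub_cancel_right, Int.toNat_natCast]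
  rw [h1]
  have h2 : N ≤ 2 * (N / q) * q := by
    have := Nat.lt_div_mul_add (a := N) (b := q) (by omega)
    nlinarith
  have h3 : (N : ℝ) ≤ 2 * ((N / q : ℕ) : ℝ) * q := by exact_mod_cast h2
  rw [div_le_iff₀ (by positivity)]
  linarith

/-- A supersolution, of order one, of the transposed Robin generator. -/
theorem exists_left_weight {m : ℕ} (hm : 1 ≤ m) {c L : ℝ} (hc0 : 0 < c) (Aminus Aplus : ℝ) :
    ∃ κ K : ℝ, ∃ N₁ : ℕ, 1 ≤ κ ∧ 0 ≤ K ∧ ∀ (N : ℕ) (b : ℕ → ℝ), N₁ ≤ N →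
      (∀ k ∈ Finset.Icc 1 m, 0 ≤ b k) → c ≤ b 1 → ∑ k ∈ Finset.Icc 1 m, b k ≤ L →
      ∃ w : Fin (N + 1) → ℝ, (∀ i, κ⁻¹ ≤ w i) ∧ (∀ i, w i ≤ κ) ∧
        ∀ i, (robinMatrix N m b Aminus Aplus).transpose.mulVec w i ≤ K * w i := by
  by_cases hcL : c ≤ L
  swap
  · refine ⟨1, 0, 0, le_rfl, le_rfl, fun N b _ hb hc hL => absurd ?_ hcL⟩
    exact hc.trans ((Finset.single_le_sum hb (by simp [hm])).trans hL)
  set ε : ℝ := c / (2 * L + 1) with hε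
  have hden : 0 < 2 * L + 1 := by linarith
  have hε0 : 0 < ε := by positivity
  have hε1 : ε ≤ 1 := by rw [hε, div_le_one hden]; linarith
  -- The boundary flux will be of size `N q c ε ^ m / 24`: the potential grows like `q ^ 2` while
  -- the mass of `w` is only known to be of order `N / q`. A large `q` therefore dominates the Robin
  -- terms.
  obtain ⟨q₀, hq₀⟩ := exists_nat_ge (24 * (|Aminus| + |Aplus|) / (c * ε ^ m))
  set q : ℕ := max q₀ 2 with hq
  have hq2 : 2 ≤ q := le_max_right _ _
  have hqA : 24 * (|Aminus| + |Aplus|) ≤ q * (c * ε ^ m) := by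
    have h1 : (q₀ : ℝ) ≤ q := by exact_mod_cast le_max_left _ _
    exact (div_le_iff₀ (by positivity)).1 (hq₀.trans h1)
  have hq0 : (0 : ℝ) < q := by positivity
  obtain ⟨N₂, hN₂⟩ := exists_nat_ge (c * (q : ℝ) ^ 2)
  have hcosh : 0 < Real.cosh ((q : ℝ) / 2) := Real.cosh_pos _
  have hcosh1 : 1 ≤ Real.cosh ((q : ℝ) / 2) := Real.one_le_cosh _
  refine ⟨Real.cosh ((q : ℝ) / 2) / ε ^ m, c * (q : ℝ) ^ 2, max N₂ (max q (2 * m)), ?_,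
    by positivity, ?_⟩
  · rw [le_div_iff₀ (by positivity), one_mul]
    exact (pow_le_one₀ hε0.le hε1).trans hcosh1
  intro N b hN hb hc hL
  have hNm : 2 * m ≤ N := le_trans (by simp) hN
  have hNq : q ≤ N := le_trans (by simp) hN
  have hNN₂ : N₂ ≤ N := le_trans (by simp) hN
  have hN1 : 1 ≤ N := by omega
  have hN0 : (0 : ℝ) < N := by positivity
  set r : ℝ := c * ((q : ℝ) / N) ^ 2 with hr
  have hr0 : 0 < r := by positivity
  have hr1 : r ≤ 1 := by
    rw [hr, div_pow, mul_div_assoc', div_le_one (by positivity)]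
    have h1 : (N₂ : ℝ) ≤ N := by exact_mod_cast hNN₂
    have h2 : (1 : ℝ) ≤ N := by exact_mod_cast hN1
    nlinarith
  obtain ⟨w, hout, h0, hwN, hsymm, hin⟩ := exists_dirichlet_solution N hb hr0
  obtain ⟨hle, hlow⟩ := dirichlet_solution_bounds hm (by omega) hb hc0 hc hL hq0 hr hr1 hout h0
    hwN hsymm hin
  let A : ℤ → ℝ := fun y => ∑ x ∈ Finset.Icc (0 : ℤ) N, w x * jumpOp N m b (pointFn y) x
  have hAin : ∀ y ∈ Finset.Icc (1 : ℤ) (N - 1), A y = r * w y := by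
    intro y hy
    rw [← hin y hy]
    exact sum_mul_jumpOp_pointFn_of_interior m b hout hy
  have hAsymm : A N = A 0 := by
    refine Finset.sum_bij (fun x _ => (N : ℤ) - x) ?_ ?_ ?_ ?_
    · intro x hx; rw [Finset.mem_Icc] at hx ⊢; omega
    · intro x _ y _ h; omega
    · intro x hx; exact ⟨N - x, by rw [Finset.mem_Icc] at hx ⊢; omega, by simp⟩
    · intro x _
      rw [hsymm, ← jumpOp_pointFn_reflect N m b x N, sub_self]
  -- Rows of the jump operator sum to zero, so its adjoint conserves mass. What is gained in the
  -- interior must be lost, in equal shares by symmetry, at the two ends.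
  have hAsum : ∑ y ∈ Finset.Icc (0 : ℤ) N, A y = 0 := by
    simp only [A]
    rw [Finset.sum_comm]
    refine Finset.sum_eq_zero fun x hx => ?_
    rw [← Finset.mul_sum, sum_jumpOp_pointFn m b hx, mul_zero]
  have hsplit : Finset.Icc (0 : ℤ) N = insert 0 (insert (N : ℤ) (Finset.Icc (1 : ℤ) (N - 1))) := by
    ext x; simp only [Finset.mem_insert, Finset.mem_Icc]; omega
  have hA0 : 2 * A 0 = -(r * ∑ y ∈ Finset.Icc (1 : ℤ) (N - 1), w y) := by
    rw [hsplit, Finset.sum_insert (by simp only [Finset.mem_insert, Finset.mem_Icc]; omega),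
      Finset.sum_insert (by simp only [Finset.mem_Icc]; omega), hAsymm,
      Finset.sum_congr rfl hAin, ← Finset.mul_sum] at hAsum
    linarith
  have hmass : ε ^ m * ((N : ℝ) / (12 * q)) ≤ ∑ y ∈ Finset.Icc (1 : ℤ) (N - 1), w y := by
    refine (mul_le_mul_of_nonneg_left (le_sum_coshFn hq2 hNq) (by positivity)).trans ?_
    rw [Finset.mul_sum]
    refine Finset.sum_le_sum fun y hy => hlow y ?_
    rw [Finset.mem_Icc] at hy ⊢; omega
  have hflux : (N : ℝ) ^ 2 * A 0 ≤ -(N * (|Aminus| + |Aplus|)) := by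
    have h1 : r * (ε ^ m * ((N : ℝ) / (12 * q)))
        ≤ r * ∑ y ∈ Finset.Icc (1 : ℤ) (N - 1), w y := mul_le_mul_of_nonneg_left hmass hr0.le
    have h2 : (N : ℝ) ^ 2 * (r * (ε ^ m * ((N : ℝ) / (12 * q)))) = N * (q * (c * ε ^ m)) / 12 := by
      rw [hr]; field_simp
    have h3 := mul_le_mul_of_nonneg_left h1 (sq_nonneg (N : ℝ))
    have h4 := mul_le_mul_of_nonneg_left hqA hN0.le
    have h5 : (N : ℝ) ^ 2 * (2 * A 0)
        = -((N : ℝ) ^ 2 * (r * ∑ y ∈ Finset.Icc (1 : ℤ) (N - 1), w y)) := by rw [hA0]; ring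
    linarith
  refine ⟨fun i => w ((i : ℕ) : ℤ), fun i => ?_, fun i => ?_, fun i => ?_⟩
  · refine le_trans ?_ (hlow _ (mem_Icc_of_fin i))
    rw [inv_div, div_eq_mul_one_div (ε ^ m)]
    have := one_le_coshFn N q ((i : ℕ) : ℤ)
    gcongr
  · refine (hle _).trans ?_
    rw [le_div_iff₀ (by positivity), one_mul]
    exact (pow_le_one₀ hε0.le hε1).trans hcosh1
  · rw [robinMatrix_transpose_mulVec]
    change (N : ℝ) ^ 2 * A ((i : ℕ) : ℤ) - _ * w ((i : ℕ) : ℤ) ≤ _ * w ((i : ℕ) : ℤ)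
    have hAm := neg_abs_le Aminus
    have hAp := neg_abs_le Aplus
    have hAm0 := abs_nonneg Aminus
    have hAp0 := abs_nonneg Aplus
    by_cases hi : i = 0 ∨ i = Fin.last N
    · have h1 : (N : ℝ) ^ 2 * A ((i : ℕ) : ℤ) ≤ -(N * (|Aminus| + |Aplus|)) := by
        rcases hi with hi | hi
        · subst hi; simpa using hflux
        · subst hi; rw [Fin.val_last, hAsymm]; exact hflux
      have h2 : w ((i : ℕ) : ℤ) = 1 := by
        rcases hi with hi | hi
        · subst hi; simpa using h0
        · subst hi; rw [Fin.val_last]; exact hwN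
      rw [h2]
      have h3 : 0 ≤ c * (q : ℝ) ^ 2 := by positivity
      have h4 := mul_le_mul_of_nonneg_left hAm hN0.le
      have h5 := mul_le_mul_of_nonneg_left hAp hN0.le
      have h6 := mul_nonneg hN0.le hAm0
      have h7 := mul_nonneg hN0.le hAp0
      rw [mul_add] at h1
      rw [mul_one, mul_one]
      split_ifs <;> linarith
    · have h1 := hi
      push Not at h1
      rw [if_neg h1.1, if_neg h1.2, hAin _ ((interior_iff i).2 hi), hr]
      refine le_of_eq ?_
      field_simp
      ring

end LeftWeight

/-! ### The supersolution of the generator, and the pair of weights. -/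

section RightWeight

theorem cosh_sub_one_le_sq {z : ℝ} (hz : |z| ≤ 1) : Real.cosh z - 1 ≤ z ^ 2 := by
  have h1 := Real.cosh_le_exp_half_sq z
  have h2 : z ^ 2 ≤ 1 := (sq_le_one_iff_abs_le_one z).2 hz
  have h3 : |z ^ 2 / 2| ≤ 1 := by rw [abs_of_nonneg (by positivity)]; linarith
  have h4 := (le_abs_self _).trans (Real.abs_exp_sub_one_le h3)
  rw [abs_of_nonneg (by positivity)] at h4
  linarith

theorem half_cosh_le_sinh {z : ℝ} (hz : 1 ≤ z) : Real.cosh z / 2 ≤ Real.sinh z := by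
  rw [Real.cosh_eq, Real.sinh_eq]
  have h1 := Real.add_one_le_exp z
  have h2 : Real.exp z * Real.exp (-z) = 1 := by rw [← Real.exp_add]; simp
  have h3 := Real.exp_pos (-z)
  nlinarith

/-- The profile increases with the distance to the midpoint, so stopping a jump at a wall can only
lower the value found there. -/
theorem coshFn_le_of_abs_le {N : ℕ} (hN : 1 ≤ N) (θ : ℝ) {x y : ℤ}
    (h : |2 * x - (N : ℤ)| ≤ |2 * y - (N : ℤ)|) : coshFn N θ x ≤ coshFn N θ y := by
  have hN0 : (0 : ℝ) < N := by positivity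
  have h1 : |2 * (x : ℝ) - N| ≤ |2 * (y : ℝ) - N| := by exact_mod_cast h
  have key : ∀ z : ℤ, |θ * ((z : ℝ) / N - 1 / 2)| = |θ| * (|2 * (z : ℝ) - N| / (2 * N)) := by
    intro z
    rw [abs_mul]
    congr 1
    rw [show (z : ℝ) / N - 1 / 2 = (2 * (z : ℝ) - N) / (2 * N) by field_simp, abs_div,
      abs_of_pos (by positivity : (0 : ℝ) < 2 * N)]
  rw [coshFn, coshFn, Real.cosh_le_cosh, key, key]
  gcongr

/-- The hyperbolic cosine profile is almost superharmonic for the stopped jump operator. -/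
theorem sq_mul_jumpOp_coshFn_le {N m : ℕ} (hN : 1 ≤ N) {b : ℕ → ℝ}
    (hb : ∀ k ∈ Finset.Icc 1 m, 0 ≤ b k) {L : ℝ} (hL : ∑ k ∈ Finset.Icc 1 m, b k ≤ L) {θ : ℝ}
    (hθ : 0 ≤ θ) (hNθ : θ * m ≤ N) {x : ℤ} (hx : x ∈ Finset.Icc (0 : ℤ) N) :
    (N : ℝ) ^ 2 * jumpOp N m b (coshFn N θ) x ≤ 2 * L * θ ^ 2 * m ^ 2 * coshFn N θ x := by
  have hN0 : (0 : ℝ) < N := by positivity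
  rw [Finset.mem_Icc] at hx
  have hpos := coshFn_pos N θ x
  have hterm : ∀ k ∈ Finset.Icc 1 m,
      b k * (coshFn N θ (min (x + k) N) + coshFn N θ (max (x - k) 0) - 2 * coshFn N θ x)
        ≤ b k * (coshFn N θ x * (2 * (θ * m / N) ^ 2)) := by
    intro k hk
    refine mul_le_mul_of_nonneg_left ?_ (hb k hk)
    rw [Finset.mem_Icc] at hk
    have h1 : coshFn N θ (min (x + k) N) ≤ coshFn N θ (x + k) := by
      refine coshFn_le_of_abs_le hN θ ?_
      rcases le_or_gt (x + k) (N : ℤ) with h | h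
      · rw [min_eq_left h]
      · rw [min_eq_right h.le, abs_of_nonneg (by omega), abs_of_nonneg (by omega)]; omega
    have h2 : coshFn N θ (max (x - k) 0) ≤ coshFn N θ (x - k) := by
      refine coshFn_le_of_abs_le hN θ ?_
      rcases le_or_gt 0 (x - k) with h | h
      · rw [max_eq_left h]
      · rw [max_eq_right h.le, abs_of_nonpos (by omega), abs_of_nonpos (by omega)]; omega
    have h3 := coshFn_add_add_sub N θ x k
    have hkm : (k : ℝ) ≤ m := by exact_mod_cast hk.2
    have h4 : θ * k / N ≤ θ * m / N := by gcongr
    have h5 : 0 ≤ θ * k / N := by positivity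
    have h6 : θ * m / N ≤ 1 := (div_le_one hN0).2 hNθ
    have h7 := cosh_sub_one_le_sq (z := θ * k / N) (by rw [abs_of_nonneg h5]; linarith)
    have h8 : (θ * k / N) ^ 2 ≤ (θ * m / N) ^ 2 := pow_le_pow_left₀ h5 h4 2
    have h9 : coshFn N θ x * (2 * (Real.cosh (θ * k / N) - 1))
        ≤ coshFn N θ x * (2 * (θ * m / N) ^ 2) :=
      mul_le_mul_of_nonneg_left (by linarith) hpos.le
    linarith
  have h1 := Finset.sum_le_sum hterm
  rw [← Finset.sum_mul] at h1
  have h2 := mul_le_mul_of_nonneg_right hL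
    (mul_nonneg hpos.le (by positivity : 0 ≤ 2 * (θ * m / N) ^ 2))
  have h3 := mul_le_mul_of_nonneg_left (h1.trans h2) (sq_nonneg (N : ℝ))
  refine h3.trans (le_of_eq ?_)
  field_simp

/-- At an end only inward jumps move, and the step `k = 1` loses about `sinh (θ / 2) * θ / N`. After
scaling this is a loss of order `N θ`, to be set against Robin terms of order `N`; the second-order
error is `O(θ ^ 2)`. -/
theorem sq_mul_jumpOp_coshFn_zero_le {N m : ℕ} (hm : 1 ≤ m) (hmN : m ≤ N) {b : ℕ → ℝ}
    (hb : ∀ k ∈ Finset.Icc 1 m, 0 ≤ b k) {c L : ℝ} (hc0 : 0 ≤ c) (hc : c ≤ b 1)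
    (hL : ∑ k ∈ Finset.Icc 1 m, b k ≤ L) {θ : ℝ} (hθ : 2 ≤ θ) (hNθ : θ ≤ N) :
    (N : ℝ) ^ 2 * jumpOp N m b (coshFn N θ) 0
      ≤ L * θ ^ 2 * coshFn N θ 0 - N * (c * θ / 2) * coshFn N θ 0 := by
  have hN : 1 ≤ N := hm.trans hmN
  have hN0 : (0 : ℝ) < N := by positivity
  have h1m : 1 ∈ Finset.Icc 1 m := by simp [hm]
  have h0 : coshFn N θ 0 = Real.cosh (θ / 2) := by
    rw [coshFn, ← Real.cosh_neg]; congr 1; push_cast; ring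
  have h1 : coshFn N θ 1 = Real.cosh (θ / 2 - θ / N) := by
    rw [coshFn, ← Real.cosh_neg]; congr 1; push_cast; ring
  have hterm : ∀ k ∈ Finset.Icc 1 m,
      0 ≤ b k * (coshFn N θ 0 - coshFn N θ k) := by
    intro k hk
    refine mul_nonneg (hb k hk) (sub_nonneg.2 (coshFn_le_of_abs_le hN θ ?_))
    rw [Finset.mem_Icc] at hk
    rw [abs_of_nonpos (by omega : (2 * 0 - (N : ℤ)) ≤ 0), abs_le]
    constructor <;> omega
  have hjump : jumpOp N m b (coshFn N θ) 0
      = -∑ k ∈ Finset.Icc 1 m, b k * (coshFn N θ 0 - coshFn N θ k) := by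
    rw [jumpOp, ← Finset.sum_neg_distrib]
    refine Finset.sum_congr rfl fun k hk => ?_
    rw [Finset.mem_Icc] at hk
    rw [show min (0 + (k : ℤ)) N = k by omega, show max (0 - (k : ℤ)) 0 = 0 by omega]
    ring
  have hsingle := Finset.single_le_sum hterm h1m
  rw [Nat.cast_one] at hsingle
  have hb1 : b 1 ≤ L := (Finset.single_le_sum hb h1m).trans hL
  set C := Real.cosh (θ / 2) with hC
  have hCpos : 0 < C := Real.cosh_pos _
  set S := Real.sinh (θ / 2) with hS
  have hSC : C / 2 ≤ S := half_cosh_le_sinh (by linarith)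
  have hz : |θ / N| ≤ 1 := by
    rw [abs_of_nonneg (by positivity)]; exact (div_le_one hN0).2 hNθ
  have hz1 := cosh_sub_one_le_sq hz
  have hz2 : θ / N ≤ Real.sinh (θ / N) := Real.self_le_sinh_iff.2 (by positivity)
  have hdiff : C * (-(θ / N) ^ 2) + S * (θ / N) ≤ coshFn N θ 0 - coshFn N θ 1 := by
    rw [h0, h1, Real.cosh_sub]
    have e1 := mul_le_mul_of_nonneg_left hz1 hCpos.le
    have e2 := mul_le_mul_of_nonneg_left hz2 (show 0 ≤ S by linarith)
    linarith
  have hd2 : C / 2 * (N * θ) - C * θ ^ 2 ≤ (N : ℝ) ^ 2 * (coshFn N θ 0 - coshFn N θ 1) := by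
    have e1 := mul_le_mul_of_nonneg_left hdiff (sq_nonneg (N : ℝ))
    have e2 : (N : ℝ) ^ 2 * (C * (-(θ / N) ^ 2) + S * (θ / N)) = S * (N * θ) - C * θ ^ 2 := by
      field_simp
      ring
    have e3 := mul_le_mul_of_nonneg_right hSC (show 0 ≤ N * θ by positivity)
    linarith
  have hfin : c * (C / 2 * (N * θ)) - L * (C * θ ^ 2)
      ≤ (N : ℝ) ^ 2 * (b 1 * (coshFn N θ 0 - coshFn N θ 1)) := by
    have e1 := mul_le_mul_of_nonneg_left hd2 (hc0.trans hc)
    have e2 := mul_le_mul_of_nonneg_right hc (show 0 ≤ C / 2 * (N * θ) by positivity)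
    have e3 := mul_le_mul_of_nonneg_right hb1 (show 0 ≤ C * θ ^ 2 by positivity)
    linarith
  have hlast := mul_le_mul_of_nonneg_left hsingle (sq_nonneg (N : ℝ))
  rw [hjump, h0]
  rw [h0] at hfin hlast
  linarith

/-- A supersolution, of order one, of the Robin generator. -/
theorem exists_right_weight {m : ℕ} (hm : 1 ≤ m) {c L : ℝ} (hc0 : 0 < c) (Aminus Aplus : ℝ) :
    ∃ κ K : ℝ, ∃ N₁ : ℕ, 1 ≤ κ ∧ 0 ≤ K ∧ ∀ (N : ℕ) (b : ℕ → ℝ), N₁ ≤ N →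
      (∀ k ∈ Finset.Icc 1 m, 0 ≤ b k) → c ≤ b 1 → ∑ k ∈ Finset.Icc 1 m, b k ≤ L →
      ∃ h : Fin (N + 1) → ℝ, (∀ i, κ⁻¹ ≤ h i) ∧ (∀ i, h i ≤ κ) ∧
        ∀ i, (robinMatrix N m b Aminus Aplus).mulVec h i ≤ K * h i := by
  by_cases hcL : c ≤ L
  swap
  · refine ⟨1, 0, 0, le_rfl, le_rfl, fun N b _ hb hc hL => absurd ?_ hcL⟩
    exact hc.trans ((Finset.single_le_sum hb (by simp [hm])).trans hL)
  -- The bound `θ ≥ 2` gives `sinh (θ / 2) ≥ cosh (θ / 2) / 2`; the other makes the boundary loss `N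
  -- c θ / 2` exceed the Robin terms.
  set θ : ℝ := max 2 (2 * (|Aminus| + |Aplus|) / c) with hθ
  have hθ2 : 2 ≤ θ := le_max_left _ _
  have hθA : |Aminus| + |Aplus| ≤ c * θ / 2 := by
    have := (div_le_iff₀ hc0).1 (le_max_right 2 (2 * (|Aminus| + |Aplus|) / c))
    linarith
  have hθ0 : 0 ≤ θ := by linarith
  obtain ⟨N₂, hN₂⟩ := exists_nat_ge (θ * m)
  have hL0 : 0 ≤ L := by linarith
  have hm1 : (1 : ℝ) ≤ m := by exact_mod_cast hm
  refine ⟨Real.cosh (θ / 2), 2 * L * θ ^ 2 * m ^ 2, max N₂ m, Real.one_le_cosh _,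
    by positivity, ?_⟩
  intro N b hN hb hc hL
  have hNm : m ≤ N := (le_max_right _ _).trans hN
  have hN1 : 1 ≤ N := hm.trans hNm
  have hN0 : (0 : ℝ) < N := by positivity
  have hNθ : θ * m ≤ N := by
    have h1 : (N₂ : ℝ) ≤ N := by exact_mod_cast (le_max_left _ _).trans hN
    linarith
  have hNθ' : θ ≤ N := by nlinarith
  refine ⟨fun i => coshFn N θ ((i : ℕ) : ℤ), fun i => ?_,
    fun i => coshFn_le hN1 hθ0 (mem_Icc_of_fin i), fun i => ?_⟩
  · exact (inv_le_one_of_one_le₀ (Real.one_le_cosh _)).trans (one_le_coshFn _ _ _)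
  rw [robinMatrix_mulVec]
  by_cases hi : i = 0 ∨ i = Fin.last N
  · have hN0eq : coshFn N θ N = coshFn N θ 0 := by
      rw [← coshFn_reflect hN1, sub_self]
    have hval : coshFn N θ ((i : ℕ) : ℤ) = coshFn N θ 0 := by
      rcases hi with hi | hi
      · subst hi; simp
      · subst hi; rw [Fin.val_last, hN0eq]
    have hjump : jumpOp N m b (coshFn N θ) ((i : ℕ) : ℤ) = jumpOp N m b (coshFn N θ) 0 := by
      rcases hi with hi | hi
      · subst hi; simp
      · subst hi
        rw [Fin.val_last, jumpOp, jumpOp]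
        refine Finset.sum_congr rfl fun k hk => ?_
        rw [Finset.mem_Icc] at hk
        rw [show min ((N : ℤ) + k) N = N by omega, show max ((N : ℤ) - k) 0 = N - k by omega,
          show min (0 + (k : ℤ)) N = k by omega, show max (0 - (k : ℤ)) 0 = 0 by omega,
          coshFn_reflect hN1, hN0eq]
        ring
    have h1 := sq_mul_jumpOp_coshFn_zero_le hm hNm hb hc0.le hc hL hθ2 hNθ'
    change _ ≤ _ * coshFn N θ ((i : ℕ) : ℤ)
    rw [hjump, hval]
    have hpos := coshFn_pos N θ 0
    set H := coshFn N θ 0 with hH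
    have h2 := mul_le_mul_of_nonneg_right (mul_le_mul_of_nonneg_left hθA hN0.le) hpos.le
    have h3 : L * θ ^ 2 * H ≤ 2 * L * θ ^ 2 * m ^ 2 * H := by
      have h4 : (1 : ℝ) ≤ 2 * m ^ 2 := by nlinarith
      have h5 := mul_le_mul_of_nonneg_left h4 (show 0 ≤ L * θ ^ 2 * H by positivity)
      linarith
    have h6 : -(N * (|Aminus| + |Aplus|)) * H ≤ ((if i = 0 then N * Aminus else 0)
        + (if i = Fin.last N then N * Aplus else 0)) * H := by
      refine mul_le_mul_of_nonneg_right ?_ hpos.le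
      have e1 := mul_le_mul_of_nonneg_left (neg_abs_le Aminus) hN0.le
      have e2 := mul_le_mul_of_nonneg_left (neg_abs_le Aplus) hN0.le
      have e3 := mul_nonneg hN0.le (abs_nonneg Aminus)
      have e4 := mul_nonneg hN0.le (abs_nonneg Aplus)
      rw [mul_add]
      split_ifs <;> linarith
    linarith
  · push Not at hi
    rw [if_neg hi.1, if_neg hi.2]
    simpa using sq_mul_jumpOp_coshFn_le hN1 hb hL hθ0 hNθ (mem_Icc_of_fin i)

/-- Uniform weights for the Robin generator. -/
theorem exists_isNashPair {m : ℕ} (hm : 1 ≤ m) {c : ℝ} (hc0 : 0 < c) (L Aminus Aplus : ℝ) :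
    ∃ κ K : ℝ, ∃ N₁ : ℕ, 1 ≤ κ ∧ 0 ≤ K ∧ ∀ (N : ℕ) (b : ℕ → ℝ), N₁ ≤ N →
      (∀ k ∈ Finset.Icc 1 m, 0 ≤ b k) → c ≤ b 1 → ∑ k ∈ Finset.Icc 1 m, b k ≤ L →
      ∃ w h : Fin (N + 1) → ℝ, IsNashPair (robinMatrix N m b Aminus Aplus) w h κ K c := by
  obtain ⟨κ₁, K₁, N₁, hκ₁, hK₁, H₁⟩ := exists_left_weight (L := L) hm hc0 Aminus Aplus
  obtain ⟨κ₂, K₂, N₂, hκ₂, hK₂, H₂⟩ := exists_right_weight (L := L) hm hc0 Aminus Aplus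
  refine ⟨max κ₁ κ₂, max K₁ K₂, max N₁ N₂, hκ₁.trans (le_max_left _ _),
    hK₁.trans (le_max_left _ _), ?_⟩
  intro N b hN hb hc hL
  obtain ⟨w, hw1, hw2, hw3⟩ := H₁ N b ((le_max_left _ _).trans hN) hb hc hL
  obtain ⟨h, hh1, hh2, hh3⟩ := H₂ N b ((le_max_right _ _).trans hN) hb hc hL
  have hinv1 : (max κ₁ κ₂)⁻¹ ≤ κ₁⁻¹ := inv_anti₀ (by linarith) (le_max_left _ _)
  have hinv2 : (max κ₁ κ₂)⁻¹ ≤ κ₂⁻¹ := inv_anti₀ (by linarith) (le_max_right _ _)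
  refine ⟨w, h, ?_, fun i => hinv1.trans (hw1 i), fun i => (hw2 i).trans (le_max_left _ _),
    fun i => hinv2.trans (hh1 i), fun i => (hh2 i).trans (le_max_right _ _), fun i => ?_,
    fun i => ?_, fun i => ?_, fun i => ?_⟩
  · intro i j hij
    rw [robinMatrix, if_neg hij, sub_zero]
    refine mul_nonneg (sq_nonneg _) (jumpOp_pointFn_nonneg N hb fun h => hij ?_)
    exact Fin.ext (by exact_mod_cast h)
  · exact (hh3 i).trans (mul_le_mul_of_nonneg_right (le_max_right _ _)
      ((inv_pos.2 (by linarith : 0 < κ₂)).le.trans (hh1 i)))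
  · exact (hw3 i).trans (mul_le_mul_of_nonneg_right (le_max_left _ _)
      ((inv_pos.2 (by linarith : 0 < κ₁)).le.trans (hw1 i)))
  · rw [robinMatrix, if_neg (Fin.castSucc_lt_succ (i := i)).ne, sub_zero, mul_comm c]
    refine mul_le_mul_of_nonneg_left (hc.trans ?_) (sq_nonneg _)
    rw [Fin.val_castSucc, Fin.val_succ, Nat.cast_add, Nat.cast_one]
    exact le_jumpOp_pointFn_succ hm hb (by have := i.2; omega)
  · rw [robinMatrix, if_neg (Fin.castSucc_lt_succ (i := i)).ne', sub_zero, mul_comm c]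
    refine mul_le_mul_of_nonneg_left (hc.trans ?_) (sq_nonneg _)
    rw [Fin.val_castSucc, Fin.val_succ, Nat.cast_add, Nat.cast_one]
    exact le_jumpOp_pointFn_pred hm hb (by omega)

end RightWeight

/-! ### Identification of the kernel and perturbation of the coefficients. -/

section Kernel

/-- Substituting the ghost value, `N ^ 2 * (φ (-1) - φ 0)` becomes `-N * Aminus * φ 0`, and likewise
at `N`. -/
theorem bdryLapOp_eq_mulVec {N m : ℕ} (hm : 1 ≤ m) (hN : 2 * m ≤ N + 1) (a : ℕ → ℝ)
    {Aminus Aplus : ℝ} {φ : ℤ → ℝ} (hl : φ (-1) = (1 - (N : ℝ)⁻¹ * Aminus) * φ 0)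
    (hr : φ (N + 1) = (1 - (N : ℝ)⁻¹ * Aplus) * φ N) (i : Fin (N + 1)) :
    bdryLapOp N m a φ ((i : ℕ) : ℤ)
      = (robinMatrix N m (fun k => a k / 2) Aminus Aplus).mulVec (fun j => φ ((j : ℕ) : ℤ)) i := by
  have hN0 : (N : ℝ) ≠ 0 := by
    have : 1 ≤ N := by omega
    positivity
  have h0 : (((i : ℕ) : ℤ) = 0) ↔ i = 0 := by
    rw [Fin.ext_iff, Fin.val_zero]; omega
  have hlast : (((i : ℕ) : ℤ) = N) ↔ i = Fin.last N := by
    rw [Fin.ext_iff, Fin.val_last]; omega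
  rw [bdryLapOp, lapOp_eq_jumpOp hN a φ (mem_Icc_of_fin i), robinMatrix_mulVec]
  have e1 : (if ((i : ℕ) : ℤ) = 0 then (N : ℝ) ^ 2 * grad (-1) φ ((i : ℕ) : ℤ) else 0)
      = -((if i = 0 then N * Aminus else 0) * φ ((i : ℕ) : ℤ)) := by
    by_cases h : i = 0
    · rw [if_pos (h0.2 h), if_pos h, grad, h0.2 h, zero_add, hl]; field_simp; ring
    · rw [if_neg (mt h0.1 h), if_neg h]; ring
  have e2 : (if ((i : ℕ) : ℤ) = N then (N : ℝ) ^ 2 * grad 1 φ ((i : ℕ) : ℤ) else 0)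
      = -((if i = Fin.last N then N * Aplus else 0) * φ ((i : ℕ) : ℤ)) := by
    by_cases h : i = Fin.last N
    · rw [if_pos (hlast.2 h), if_pos h, grad, hlast.2 h, hr]; field_simp; ring
    · rw [if_neg (mt hlast.1 h), if_neg h]; ring
  rw [e1, e2]; ring

/-- The Robin heat kernel is the exponential of the Robin generator. -/
theorem IsRobinHeatKernel.eq_exp {N m : ℕ} (hm : 1 ≤ m) (hN : 2 * m ≤ N + 1) {a : ℕ → ℝ}
    {Aminus Aplus : ℝ} {U : ℝ → ℝ → ℤ → ℤ → ℝ} (hU : IsRobinHeatKernel N m a Aminus Aplus U)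
    {S T : ℝ} (hS : 0 ≤ S) (hST : S ≤ T) (i j : Fin (N + 1)) :
    U S T ((i : ℕ) : ℤ) ((j : ℕ) : ℤ)
      = NormedSpace.exp ((T - S) • robinMatrix N m (fun k => a k / 2) Aminus Aplus) i j := by
  set G := robinMatrix N m (fun k => a k / 2) Aminus Aplus with hG
  let u : ℝ → Fin (N + 1) → ℝ := fun R i => U S R ((i : ℕ) : ℤ) ((j : ℕ) : ℤ)
  let v : ℝ → Fin (N + 1) → ℝ := fun R => (NormedSpace.exp ((R - S) • G)).mulVec (Pi.single j 1)
  have hj := mem_Icc_of_fin j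
  have hu : ∀ R, S ≤ R → HasDerivWithinAt u (G.mulVec (u R)) (Set.Ici S) R := by
    intro R hR
    rw [hasDerivWithinAt_pi]
    intro i
    have h1 := hU.evolution S R hS hR _ (mem_Icc_of_fin i) _ hj
    rwa [bdryLapOp_eq_mulVec hm hN a (hU.left_bdry S R hS hR _ hj)
      (hU.right_bdry S R hS hR _ hj) i] at h1
  have hv : ∀ R, HasDerivAt v (G.mulVec (v R)) R := fun R =>
    HasDerivAt.comp_sub_const R S (hasDerivAt_exp_mulVec G (Pi.single j 1) (R - S))
  let Glin : (Fin (N + 1) → ℝ) →L[ℝ] (Fin (N + 1) → ℝ) :=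
    LinearMap.toContinuousLinearMap G.mulVecLin
  have heq : Set.EqOn u v (Set.Icc S T) := by
    refine ODE_solution_unique (v := fun _ => Glin) (fun _ => Glin.lipschitz)
      (fun R hR => ((hu R hR.1).mono Set.Icc_subset_Ici_self).continuousWithinAt)
      (fun R hR => (hu R hR.1).mono (Set.Ici_subset_Ici.2 hR.1))
      (fun R _ => (hv R).continuousAt.continuousWithinAt)
      (fun R _ => (hv R).hasDerivWithinAt) ?_
    funext i
    simp only [u, v]
    rw [hU.initial S hS _ (mem_Icc_of_fin i) _ hj, sub_self, zero_smul, NormedSpace.exp_zero,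
      Matrix.one_mulVec, Pi.single_apply]
    have : (((i : ℕ) : ℤ) = ((j : ℕ) : ℤ)) ↔ i = j := by rw [Fin.ext_iff]; omega
    simp only [this]
  have h1 := congrFun (heq ⟨hST, le_rfl⟩) i
  simp only [u, v] at h1
  rw [h1, Matrix.mulVec_single_one]
  rfl

/-- The modified coefficients differ from the original ones by `O(N⁻¹)`. -/
theorem abs_alphaTilde_sub_le {N m : ℕ} {lam Lam : ℝ} {α : ℕ → ℝ}
    (hα : ∀ k ∈ Finset.Icc 1 m, 0 < α k) (hLam : ∑ k ∈ Finset.Icc 1 m, (k : ℝ) ^ 2 * α k ≤ Lam)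
    {k : ℕ} (hk : k ∈ Finset.Icc 1 m) :
    |alphaTilde N m lam α k - α k| ≤ (N : ℝ)⁻¹ * (lam ^ 2 * (m + 2) * Lam) ∧ α k ≤ Lam := by
  have hsq : ∀ l ∈ Finset.Icc 1 m, 0 ≤ (l : ℝ) ^ 2 * α l :=
    fun l hl => mul_nonneg (sq_nonneg _) (hα l hl).le
  have hk' := hk
  rw [Finset.mem_Icc] at hk'
  have hk1 : (1 : ℝ) ≤ k := by exact_mod_cast hk'.1
  have hkm : (k : ℝ) ≤ m := by exact_mod_cast hk'.2
  have hαk := hα k hk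
  have hαL : α k ≤ Lam := by
    have h1 := (Finset.single_le_sum hsq hk).trans hLam
    have h2 : (1 : ℝ) ≤ (k : ℝ) ^ 2 := one_le_pow₀ hk1
    nlinarith
  refine ⟨?_, hαL⟩
  have hLam0 : 0 ≤ Lam := hαk.le.trans hαL
  set s := ∑ l ∈ Finset.Icc (k + 1) m, (2 * (l : ℝ) - (k : ℝ)) * α l with hs
  have hsub : Finset.Icc (k + 1) m ⊆ Finset.Icc 1 m := Finset.Icc_subset_Icc (by omega) le_rfl
  have hs0 : 0 ≤ s := by
    refine Finset.sum_nonneg fun l hl => mul_nonneg ?_ (hα l (hsub hl)).le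
    rw [Finset.mem_Icc] at hl
    have : ((k + 1 : ℕ) : ℝ) ≤ l := by exact_mod_cast hl.1
    push_cast at this
    linarith
  have hs2 : s ≤ 2 * Lam := by
    refine le_trans ?_ (mul_le_mul_of_nonneg_left hLam two_pos.le)
    rw [Finset.mul_sum]
    refine (Finset.sum_le_sum fun l hl => ?_).trans
      (Finset.sum_le_sum_of_subset_of_nonneg hsub fun l hl _ => mul_nonneg two_pos.le (hsq l hl))
    have hl1 : (1 : ℝ) ≤ l := by
      have := hsub hl
      rw [Finset.mem_Icc] at this
      exact_mod_cast this.1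
    rw [← mul_assoc]
    exact mul_le_mul_of_nonneg_right (by nlinarith) (hα l (hsub hl)).le
  have hdiff : alphaTilde N m lam α k - α k
      = (N : ℝ)⁻¹ * (lam ^ 2 * (((k : ℝ) - 2) / 2 * α k - s / k)) := by
    rw [alphaTilde, ← hs]; ring
  rw [hdiff, abs_mul, abs_mul, abs_of_nonneg (by positivity : (0 : ℝ) ≤ (N : ℝ)⁻¹),
    abs_of_nonneg (sq_nonneg lam), mul_assoc (lam ^ 2)]
  refine mul_le_mul_of_nonneg_left (mul_le_mul_of_nonneg_left ?_ (sq_nonneg lam)) (by positivity)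
  have h1 : 0 ≤ s / k := by positivity
  have h2 : s / k ≤ 2 * Lam := (div_le_self hs0 hk1).trans hs2
  have h3 : ((k : ℝ) - 2) / 2 * α k ≤ m * Lam :=
    (mul_le_mul_of_nonneg_right (by linarith) hαk.le).trans
      (mul_le_mul_of_nonneg_left hαL (by positivity))
  have h4 : -(1 * Lam) ≤ ((k : ℝ) - 2) / 2 * α k := by
    have h5 : -1 * α k ≤ ((k : ℝ) - 2) / 2 * α k :=
      mul_le_mul_of_nonneg_right (by linarith) hαk.le
    linarith
  have h6 : Lam ≤ m * Lam := le_mul_of_one_le_left hLam0 (by linarith)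
  rw [abs_le]
  constructor <;> linarith

/-- For bounded `N` the target bound thus stays away from zero, uniformly in time. -/
theorem inv_le_nashBound {N : ℕ} (hN : 1 ≤ N) {ρ : ℝ} (hρ : 0 ≤ ρ) :
    (N : ℝ)⁻¹ ≤ nashBound N ρ := by
  have h1 : (N : ℝ)⁻¹ ≤ 1 := inv_le_one_of_one_le₀ (by exact_mod_cast hN)
  rw [nashBound]
  split_ifs
  · exact h1
  · refine le_min ?_ h1
    have : 0 ≤ (N : ℝ)⁻¹ * ρ ^ (-(1 / 2) : ℝ) := by positivity
    linarith

end Kernel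

end RobinHeat

/-! ### The main theorem: large `N` by Nash, small `N` by the operator norm. -/

open RobinHeat

theorem mainTheorem3 (m : ℕ) (hm : 1 ≤ m) (N₀ : ℕ) (lam c Lam Tf Aminus Aplus : ℝ) (hc : 0 < c) :
    ∃ C : ℝ, 0 < C ∧
      ∀ (N : ℕ) (α : ℕ → ℝ) (U : ℝ → ℝ → ℤ → ℤ → ℝ),
        2 * m ≤ N + 1 →
        (∀ k ∈ Finset.Icc 1 m, 0 < α k) →
        c ≤ α 1 →
        ∑ k ∈ Finset.Icc 1 m, (k : ℝ) ^ 2 * α k ≤ Lam →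
        (N₀ ≤ N → ∀ k ∈ Finset.Icc 1 m, 0 ≤ RobinHeat.alphaTilde N m lam α k) →
        RobinHeat.IsRobinHeatKernel N m (RobinHeat.alphaTilde N m lam α) Aminus Aplus U →
        ∀ S T : ℝ, 0 ≤ S → S ≤ T → T ≤ Tf →
          (∀ x ∈ Finset.Icc (0 : ℤ) N, ∀ y ∈ Finset.Icc (0 : ℤ) N,
            |U S T x y| ≤ C * RobinHeat.nashBound N |T - S|) ∧
          (∀ x ∈ Finset.Icc (0 : ℤ) N,
            ∑ y ∈ Finset.Icc (0 : ℤ) N, |U S T x y| ≤ C) := by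
  -- The constants are fixed before `Lam` is known to be nonnegative, hence the absolute value.
  set E : ℝ := lam ^ 2 * (m + 2) * |Lam| with hE
  have hE0 : 0 ≤ E := by positivity
  set L : ℝ := m * (|Lam| + E) with hL
  have hL0 : 0 ≤ L := by positivity
  obtain ⟨κ, K, N₁, hκ, hK, H⟩ :=
    exists_isNashPair hm (c := c / 4) (by positivity) L Aminus Aplus
  obtain ⟨C₁, hC₁, H₁⟩ := exists_heatKernel_bound κ K (c / 4) Tf hκ hK (by positivity)
  -- From here on the correction `E / N` is at most `c / 2`, so `alphaTilde` at one is at least `c /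
  -- 2` and the rate `b 1`, which is half of it, at least `c / 4`.
  obtain ⟨N₂, hN₂⟩ := exists_nat_ge (2 * E / c)
  set N₃ : ℕ := max (max N₀ N₁) N₂ with hN₃
  set B : ℝ := (N₃ : ℝ) ^ 2 * (4 * L) + N₃ * (|Aminus| + |Aplus|) with hB
  have hB0 : 0 ≤ B := by positivity
  set C₂ : ℝ := Real.exp (max Tf 0 * B) with hC₂
  have hC₂0 : 0 < C₂ := Real.exp_pos _
  -- For `N < N₃` the pointwise bound uses `N₃ * C₂`, because `1 ≤ N₃ * nashBound`, and the row sums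
  -- use the extra `C₂`.
  refine ⟨C₁ + (N₃ + 1) * C₂, by positivity, ?_⟩
  intro N α U hN hα hcα hLam hpos hU S T hS hST hT
  have hN1 : 1 ≤ N := by omega
  have hNpos : (0 : ℝ) < N := by positivity
  have hNinv : (N : ℝ)⁻¹ ≤ 1 := inv_le_one_of_one_le₀ (by exact_mod_cast hN1)
  have h1m : 1 ∈ Finset.Icc 1 m := by simp [hm]
  set b : ℕ → ℝ := fun k => alphaTilde N m lam α k / 2 with hb
  have hclose : ∀ k ∈ Finset.Icc 1 m, |alphaTilde N m lam α k - α k| ≤ (N : ℝ)⁻¹ * E ∧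
      α k ≤ |Lam| := fun k hk => abs_alphaTilde_sub_le hα (hLam.trans (le_abs_self Lam)) hk
  have hbL : ∑ k ∈ Finset.Icc 1 m, |b k| ≤ L := by
    have h1 : ∀ k ∈ Finset.Icc 1 m, |b k| ≤ |Lam| + E := by
      intro k hk
      obtain ⟨h2, h3⟩ := hclose k hk
      have h4 : (N : ℝ)⁻¹ * E ≤ 1 * E := mul_le_mul_of_nonneg_right hNinv hE0
      have h5 := hα k hk
      rw [abs_le] at h2 ⊢
      simp only [hb]
      constructor <;> linarith [abs_nonneg Lam]
    refine (Finset.sum_le_card_nsmul _ _ _ h1).trans (le_of_eq ?_)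
    rw [Nat.card_Icc, nsmul_eq_mul, Nat.add_sub_cancel]
  have hρ : 0 ≤ T - S := sub_nonneg.2 hST
  have hρT : T - S ≤ Tf := by linarith
  set G := robinMatrix N m b Aminus Aplus with hG
  have hnash := inv_le_nashBound hN1 hρ
  have hnash0 : 0 ≤ nashBound N (T - S) := (by positivity : (0 : ℝ) ≤ (N : ℝ)⁻¹).trans hnash
  have hN₃0 : (0 : ℝ) ≤ N₃ := Nat.cast_nonneg _
  have hN₃C : 0 ≤ N₃ * C₂ := mul_nonneg hN₃0 hC₂0.le
  suffices hmat : (∀ i j, |NormedSpace.exp ((T - S) • G) i j|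
      ≤ (C₁ + (N₃ + 1) * C₂) * nashBound N (T - S)) ∧
      ∀ i, ∑ j, |NormedSpace.exp ((T - S) • G) i j| ≤ C₁ + (N₃ + 1) * C₂ by
    have hkernel := fun i j => hU.eq_exp hm hN hS hST i j
    rw [abs_of_nonneg hρ]
    refine ⟨fun x hx y hy => ?_, fun x hx => ?_⟩
    · obtain ⟨i, rfl⟩ := exists_fin_of_mem_Icc hx
      obtain ⟨j, rfl⟩ := exists_fin_of_mem_Icc hy
      rw [hkernel]
      exact hmat.1 i j
    · obtain ⟨i, rfl⟩ := exists_fin_of_mem_Icc hx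
      rw [← sum_fin_eq_sum_Icc N (fun y => |U S T ((i : ℕ) : ℤ) y|)]
      simp only [hkernel]
      exact hmat.2 i
  rcases le_or_gt N₃ N with hlarge | hsmall
  · have hNN₀ : N₀ ≤ N := ((le_max_left _ _).trans (le_max_left _ _)).trans hlarge
    have hNN₁ : N₁ ≤ N := ((le_max_right _ _).trans (le_max_left _ _)).trans hlarge
    have hNN₂ : (N₂ : ℝ) ≤ N := by exact_mod_cast (le_max_right _ _).trans hlarge
    have hb0 : ∀ k ∈ Finset.Icc 1 m, 0 ≤ b k := fun k hk => div_nonneg (hpos hNN₀ k hk) two_pos.le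
    have hb1 : c / 4 ≤ b 1 := by
      have h1 := (abs_le.1 (hclose 1 h1m).1).1
      have h2 : (N : ℝ)⁻¹ * E ≤ c / 2 := by
        have h3 := (div_le_iff₀ hc).1 (hN₂.trans hNN₂)
        rw [inv_mul_eq_div, div_le_iff₀ hNpos]
        linarith
      simp only [hb]
      linarith
    have hbL' : ∑ k ∈ Finset.Icc 1 m, b k ≤ L :=
      (Finset.sum_le_sum fun k _ => le_abs_self (b k)).trans hbL
    obtain ⟨w, h, hpair⟩ := H N b hNN₁ hb0 hb1 hbL'
    obtain ⟨h1, h2⟩ := H₁ N G w h hN1 hpair (T - S) hρ hρT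
    refine ⟨fun i j => (h1 i j).trans (mul_le_mul_of_nonneg_right (by linarith) hnash0),
      fun i => (h2 i).trans (by linarith)⟩
  · have hNN₃ : (N : ℝ) ≤ N₃ := by exact_mod_cast hsmall.le
    have hrow : ∀ i, ∑ j, |G i j| ≤ B := by
      intro i
      refine (sum_abs_robinMatrix_le N m Aminus Aplus hbL i).trans ?_
      have h1 : (N : ℝ) ^ 2 ≤ (N₃ : ℝ) ^ 2 := pow_le_pow_left₀ hNpos.le hNN₃ 2
      have h2 : 0 ≤ |Aminus| + |Aplus| := by positivity
      rw [hB]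
      gcongr
    have hexp : ∀ i, ∑ j, |NormedSpace.exp ((T - S) • G) i j| ≤ C₂ := by
      intro i
      refine (sum_abs_exp_le hrow hB0 hρ i).trans (Real.exp_le_exp.2 ?_)
      exact mul_le_mul_of_nonneg_right (hρT.trans (le_max_left _ _)) hB0
    refine ⟨fun i j => ?_, fun i => (hexp i).trans (by linarith)⟩
    have h1 : |NormedSpace.exp ((T - S) • G) i j| ≤ C₂ :=
      (Finset.single_le_sum (f := fun j => |NormedSpace.exp ((T - S) • G) i j|)
        (fun _ _ => abs_nonneg _) (Finset.mem_univ j)).trans (hexp i)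
    have h2 : 1 ≤ N₃ * nashBound N (T - S) :=
      calc (1 : ℝ) = N * (N : ℝ)⁻¹ := (mul_inv_cancel₀ hNpos.ne').symm
        _ ≤ N₃ * nashBound N (T - S) := mul_le_mul hNN₃ hnash (by positivity) hN₃0
    have h3 := mul_le_mul_of_nonneg_left h2 hC₂0.le
    have h4 := mul_nonneg hC₁.le hnash0
    have h5 := mul_nonneg hC₂0.le hnash0
    linarith
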